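/- **Setting.** Fix $r,t\in\mathbb N$. For each $n$ let $[n]=N_1\sqcup\dots\sqcup N_r$ be a partition into disjoint intervals (depending on $n$), all of them nonempty for all sufficiently large $n$, and assume that $|N_q|/n\to d_q$ as $n\to\infty$ for each $q\in[r]$ (so $d_q\ge 0$; the value $d_q=0$ is allowed). Let $D_q$ be the $n\times n$ diagonal $0$-$1$ matrix with $(D_q)_{jj}=1$ iff $j\in N_q$. The symmetric blocks of an $n\times n$ random matrix $Y(u,n)$ are $T_{q,q}(u,n)=D_qY(u,n)D_q$ and $T_{p,q}(u,n)=D_pY(u,n)D_q+D_qY(u,n)D_p$ for $p\ne q$. For an $n\times n$ random matrix $A$ put $\tau_q(n)(A)=\mathbb E\big(\tfrac1{|N_q|}\sum_{j\in N_q}A_{jj}\big)$. For $u\in[t]$ let $(v_{p,q}(u))_{p,q\in[r]}$ be a symmetric matrix of nonnegative real numbers, and put $b_{p,q}(2u-1)=b_{p,q}(2u)=d_p\,v_{p,q}(u)$. Let $\mathcal M$ be the Hilbert space with orthonormal basis consisting of vacuum vectors $\Omega_1,\dots,\Omega_r$ and the simple tensors $e_{p_1,p_2}(k_1)\otimes e_{p_2,p_3}(k_2)\otimes\dots\otimes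 e_{p_l,p_{l+1}}(k_l)$ with $l\ge1$, $p_1,\dots,p_{l+1}\in[r]$ and $k_1,\dots,k_l\in[2t]$ (the matricially free Fock space of tracial type). For $p,q\in[r]$ and $k\in[2t]$ let $\wp_{p,q}(k)$ be the bounded operator on $\mathcal M$ with $$\wp_{p,q}(k)\Omega_q=\sqrt{b_{p,q}(k)}\,e_{p,q}(k),\qquad \wp_{p,q}(k)(e_{q,s}(k')\otimes w)=\sqrt{b_{p,q}(k)}\,e_{p,q}(k)\otimes e_{q,s}(k')\otimes w$$ for all basis vectors $e_{q,s}(k')\otimes w$ beginning with some $e_{q,s}(k')$, and with $\wp_{p,q}(k)$ equal to zero on the remaining basis vectors. Put $\widehat\wp_{q,q}(k)=\wp_{q,q}(k)$, $\widehat\wp_{p,q}(k)=\wp_{p,q}(k)+\wp_{q,p}(k)$ for $p\neq q$, and, for $u\in[t]$, $$\eta_{p,q}(u)=\widehat\wp_{p,q}(2u-1)+\widehat\wp_{p,q}^{\,*}(2u).$$ Let $\Psi_q(a)=\langle a\Omega_q,\Omega_q\rangle$ for bounded operators $a$ on $\mathcal M$. **Theorem 8.1.** Let $Y(u,n)$,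 $u\in[t]$, $n\in\mathbb N$, be complex $n\times n$ random matrices on a probability space such that, for each $n$, $$\{\operatorname{Re}Y_{i,j}(u,n),\ \operatorname{Im}Y_{i,j}(u,n):\ i,j\in[n],\ u\in[t]\}$$ is a family of independent Gaussian random variables with mean zero and variances $$\mathbb E\big((\operatorname{Re}Y_{i,j}(u,n))^2\big)=\mathbb E\big((\operatorname{Im}Y_{i,j}(u,n))^2\big)=\frac{v_{p,q}(u)}{2n}\qquad\text{for } (i,j)\in N_p\times N_q,\ p,q\in[r],\ u\in[t]$$ (a Gaussian variable of variance $0$ being almost surely $0$). Then, for every $m\ge 0$, all $\epsilon_1,\dots,\epsilon_m\in\{1,*\}$, $u_1,\dots,u_m\in[t]$ and $q,p_1,q_1,\dots,p_m,q_m\in[r]$, the expectations defining the left-hand side below exist for every $n$ with $N_q\neq\emptyset$, and $$\lim_{n\to\infty}\tau_q(n)\big(T^{\epsilon_1}_{p_1,q_1}(u_1,n)\cdots T^{\epsilon_m}_{p_m,q_m}(u_m,n)\big)=\Psi_q\big(\eta^{\epsilon_1}_{p_1,q_1}(u_1)\cdots\eta^{\epsilon_m}_{p_m,q_m}(u_m)\big).$$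 -/

import Mathlib

open MeasureTheory ProbabilityTheory Filter Topology
open scoped NNReal InnerProductSpace

noncomputable section

namespace MatricialFock

/-! ### The matricially free Fock space of tracial type and its operators -/

/-- Index set of the orthonormal basis of the matricially free Fock space of tracial type over
one-dimensional spaces `ℂ e_{p,q}(u)`, for `p, q ∈ [r]` and `u ∈ U`.  The pair
`([(p₁, u₁), …, (pₘ, uₘ)], q)` stands for the simple tensor
`e_{p₁,p₂}(u₁) ⊗ e_{p₂,p₃}(u₂) ⊗ ⋯ ⊗ e_{pₘ,q}(uₘ)` (neighbouring factors share a colour, so each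
colour is recorded once), and `([], q)` stands for the vacuum vector `Ω_q`. -/
abbrev FockIndex (r : ℕ) (U : Type) : Type := List (Fin r × U) × Fin r

/-- The matricially free Fock space: the Hilbert space with orthonormal basis `FockIndex r U`. -/
abbrev FockSpace (r : ℕ) (U : Type) : Type := lp (fun _ : FockIndex r U => ℂ) 2

variable {r : ℕ} {U : Type}

/-- The first colour of a basis vector: `q` for `Ω_q`, and `p` for `e_{p,s}(u) ⊗ w`. -/
def headColor : FockIndex r U → Fin r
  | ([], q) => q
  | (a :: _, _) => a.1

/-- Prepending the letter `(p, u)`. -/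
def prepend (p : Fin r) (u : U) (w : FockIndex r U) : FockIndex r U := ((p, u) :: w.1, w.2)

theorem prepend_injective (p : Fin r) (u : U) : Function.Injective (prepend (r := r) p u) := by
  rintro ⟨l, s⟩ ⟨l', s'⟩ h
  simpa [prepend] using h

theorem summable_sq (x : FockSpace r U) : Summable fun w => ‖x w‖ ^ 2 := by
  have h := (memℓp_gen_iff (p := 2) (by norm_num)).1 (lp.memℓp x)
  simpa using h

theorem norm_sq_eq_tsum (x : FockSpace r U) : ‖x‖ ^ 2 = ∑' w, ‖x w‖ ^ 2 := by
  have h := lp.norm_rpow_eq_tsum (p := 2) (by norm_num) x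
  simpa using h

variable [DecidableEq U]

/-- The basis vector (simple tensor or vacuum vector) with a given index. -/
def basisVec (w : FockIndex r U) : FockSpace r U := lp.single 2 w (1 : ℂ)

/-- The vacuum vector `Ω_q`. -/
def vacuum (q : Fin r) : FockSpace r U := basisVec ([], q)

/-- Coordinates of the image of `x` under the operator that sends a basis vector `w` with first
colour `q` to `e_{p,q}(u) ⊗ w` (with `e_{p,q}(u) ⊗ Ω_q` read as `e_{p,q}(u)`), and all other
basis vectors to zero. -/
def shiftCoord (p q : Fin r) (u : U) (x : FockIndex r U → ℂ) : FockIndex r U → ℂ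
  | ([], _) => 0
  | (a :: l, s) => if a = (p, u) ∧ headColor (l, s) = q then x (l, s) else 0

theorem shiftCoord_prepend (p q : Fin r) (u : U) (x : FockIndex r U → ℂ) (w : FockIndex r U) :
    shiftCoord p q u x (prepend p u w) = if headColor w = q then x w else 0 := by
  simp [shiftCoord, prepend]

theorem shiftCoord_eq_zero (p q : Fin r) (u : U) (x : FockIndex r U → ℂ) (w : FockIndex r U)
    (hw : w ∉ Set.range (prepend p u)) : shiftCoord p q u x w = 0 := by
  rcases w with ⟨_ | ⟨a, l⟩, s⟩
  · rfl
  · simp only [shiftCoord]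
    rw [if_neg]
    rintro ⟨rfl, -⟩
    exact hw ⟨(l, s), rfl⟩

theorem shiftCoord_comp_le (p q : Fin r) (u : U) (x : FockIndex r U → ℂ) (w : FockIndex r U) :
    ‖shiftCoord p q u x (prepend p u w)‖ ^ 2 ≤ ‖x w‖ ^ 2 := by
  rw [shiftCoord_prepend]
  split_ifs
  · exact le_rfl
  · simp

theorem summable_shiftCoord_comp (p q : Fin r) (u : U) (x : FockSpace r U) :
    Summable fun w => ‖shiftCoord p q u x (prepend p u w)‖ ^ 2 :=
  Summable.of_nonneg_of_le (fun _ => by positivity) (shiftCoord_comp_le p q u x) (summable_sq x)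

theorem memℓp_shiftCoord (p q : Fin r) (u : U) (x : FockSpace r U) :
    Memℓp (shiftCoord p q u x) 2 := by
  rw [memℓp_gen_iff (by norm_num)]
  have h := ((prepend_injective p u).summable_iff
    (f := fun w => ‖shiftCoord p q u x w‖ ^ 2)
    (fun w hw => by simp [shiftCoord_eq_zero p q u x w hw])).1 (summable_shiftCoord_comp p q u x)
  simpa using h

/-- `shiftCoord` as a linear map of the Fock space. -/
def shiftLin (p q : Fin r) (u : U) : FockSpace r U →ₗ[ℂ] FockSpace r U where
  toFun x := ⟨shiftCoord p q u x, memℓp_shiftCoord p q u x⟩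
  map_add' x y := by
    ext w
    rcases w with ⟨_ | ⟨a, l⟩, s⟩
    · exact (add_zero (0 : ℂ)).symm
    · simp only [shiftCoord, lp.coeFn_add, Pi.add_apply]
      split_ifs <;> simp
  map_smul' c x := by
    ext w
    rcases w with ⟨_ | ⟨a, l⟩, s⟩
    · simp [shiftCoord]
    · simp only [shiftCoord, lp.coeFn_smul, Pi.smul_apply, RingHom.id_apply]
      split_ifs <;> simp

theorem norm_shiftLin_le (p q : Fin r) (u : U) (x : FockSpace r U) :
    ‖shiftLin p q u x‖ ≤ 1 * ‖x‖ := by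
  rw [one_mul]
  refine le_of_sq_le_sq ?_ (norm_nonneg _)
  rw [norm_sq_eq_tsum, norm_sq_eq_tsum]
  have h := (prepend_injective (r := r) p u).tsum_eq
    (f := fun w => ‖shiftCoord p q u x w‖ ^ 2) (fun w hw => by
      by_contra hn
      exact hw (by simp [shiftCoord_eq_zero p q u x w hn]))
  change ∑' w, ‖shiftCoord p q u x w‖ ^ 2 ≤ _
  rw [← h]
  exact (summable_shiftCoord_comp p q u x).tsum_le_tsum (shiftCoord_comp_le p q u x)
    (summable_sq x)

/-- The matricially free creation operator `℘_{p,q}(u)` with covariances `b u p q`: it sends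
`Ω_q` to `√(b_{p,q}(u)) e_{p,q}(u)` and `e_{q,s}(t) ⊗ w` to
`√(b_{p,q}(u)) e_{p,q}(u) ⊗ e_{q,s}(t) ⊗ w`, and all other basis vectors to zero. -/
def creation (b : U → Fin r → Fin r → ℝ) (p q : Fin r) (u : U) :
    FockSpace r U →L[ℂ] FockSpace r U :=
  (Real.sqrt (b u p q) : ℂ) • (shiftLin p q u).mkContinuous 1 (norm_shiftLin_le p q u)

/-- The defining formula of the creation operator on the orthonormal basis. -/
theorem creation_basisVec (b : U → Fin r → Fin r → ℝ) (p q : Fin r) (u : U)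
    (w : FockIndex r U) :
    creation b p q u (basisVec w) =
      if headColor w = q then (Real.sqrt (b u p q) : ℂ) • basisVec (prepend p u w) else 0 := by
  have key : shiftLin p q u (basisVec w) =
      if headColor w = q then basisVec (prepend p u w) else 0 := by
    ext w'
    change shiftCoord p q u (basisVec w) w' = _
    by_cases hw' : w' ∈ Set.range (prepend p u)
    · obtain ⟨v, rfl⟩ := hw'
      rw [shiftCoord_prepend]
      by_cases hv : v = w
      · subst hv
        split_ifs <;> simp [basisVec]
      · have hv' : prepend p u v ≠ prepend p u w := fun h => hv (prepend_injective p u h)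
        split_ifs <;> simp [basisVec, hv, hv']
    · rw [shiftCoord_eq_zero p q u _ w' hw']
      have hne : w' ≠ prepend p u w := fun h => hw' ⟨w, h.symm⟩
      split_ifs <;> simp [basisVec, hne]
  change (Real.sqrt (b u p q) : ℂ) • shiftLin p q u (basisVec w) = _
  rw [key]
  split_ifs <;> simp

/-- The symmetrized creation operator: `℘_{q,q}(u)` if `p = q`, and `℘_{p,q}(u) + ℘_{q,p}(u)`
if `p ≠ q`. -/
def symCreation (b : U → Fin r → Fin r → ℝ) (p q : Fin r) (u : U) :
    FockSpace r U →L[ℂ] FockSpace r U :=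
  if p = q then creation b q q u else creation b p q u + creation b q p u

/-- The state `Ψ_q(a) = ⟨a Ω_q, Ω_q⟩` (in Mathlib the inner product is linear in its second
argument). -/
def vacuumState (q : Fin r) (a : FockSpace r U →L[ℂ] FockSpace r U) : ℂ :=
  inner ℂ (vacuum q) (a (vacuum q))

/-- The index `2u - 1` of `[2t]` for `u ∈ [t]`, counted from zero. -/
def oddIdx {t : ℕ} (u : Fin t) : Fin (2 * t) := ⟨2 * u.1, by omega⟩

/-- The index `2u` of `[2t]` for `u ∈ [t]`, counted from zero. -/
def evenIdx {t : ℕ} (u : Fin t) : Fin (2 * t) := ⟨2 * u.1 + 1, by omega⟩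

/-- The covariances `b_{p,q}(2u - 1) = b_{p,q}(2u) = d_p v_{p,q}(u)`. -/
def blockCovariance {t : ℕ} (d : Fin r → ℝ) (v : Fin t → Fin r → Fin r → ℝ≥0) :
    Fin (2 * t) → Fin r → Fin r → ℝ :=
  fun k p q => d p * (v ⟨k.1 / 2, by omega⟩ p q : ℝ)

/-- `η_{p,q}(u) = ℘^_{p,q}(2u - 1) + ℘^*_{p,q}(2u)`, with symmetrized creation operators and
their adjoints. -/
def eta {t : ℕ} (d : Fin r → ℝ) (v : Fin t → Fin r → Fin r → ℝ≥0) (p q : Fin r) (u : Fin t) :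
    FockSpace r (Fin (2 * t)) →L[ℂ] FockSpace r (Fin (2 * t)) :=
  symCreation (blockCovariance d v) p q (oddIdx u) +
    ContinuousLinearMap.adjoint (symCreation (blockCovariance d v) p q (evenIdx u))

/-! ### Symmetric blocks and partial traces -/

/-- `x^ε` for `ε ∈ {1, *}`, with `true` for `*`. -/
def starPow {A : Type*} [Star A] (ε : Bool) (x : A) : A := if ε then star x else x

/-- The diagonal projection matrix onto the coordinates in `S`. -/
def blockProj {n : ℕ} (S : Finset (Fin n)) : Matrix (Fin n) (Fin n) ℂ :=
  Matrix.diagonal fun j => if j ∈ S then 1 else 0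

/-- The symmetric block `T_{p,q}` of the matrix `Y`, for the family `N` of index sets. -/
def symBlock {n : ℕ} (N : Fin r → Finset (Fin n)) (p q : Fin r) (Y : Matrix (Fin n) (Fin n) ℂ) :
    Matrix (Fin n) (Fin n) ℂ :=
  if p = q then blockProj (N q) * Y * blockProj (N q)
  else blockProj (N p) * Y * blockProj (N q) + blockProj (N q) * Y * blockProj (N p)

/-- The normalized partial trace over the coordinates in `S`. -/
def partialTrace {n : ℕ} (S : Finset (Fin n)) (A : Matrix (Fin n) (Fin n) ℂ) : ℂ :=
  (∑ j ∈ S, A j j) / (S.card : ℂ)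

/-- The partial trace composed with the classical expectation. -/
def expPartialTrace {Ω : Type*} [MeasurableSpace Ω] (P : Measure Ω) {n : ℕ} (S : Finset (Fin n))
    (A : Ω → Matrix (Fin n) (Fin n) ℂ) : ℂ :=
  ∫ ω, partialTrace S (A ω) ∂P

/-- The real part (`false`) or the imaginary part (`true`) of a complex number. -/
def reIm (c : Bool) (z : ℂ) : ℝ := if c then z.im else z.re

end MatricialFock

end

noncomputable section

namespace MatricialFock

/-! ### Gaussian integration by parts -/

/-! Symmetric blocks are sums of rectangular blocks `D_p Y(u)^ε D_q`, so it suffices to treat words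
in these. The limit holds because matrix moments and vacuum moments obey the same recursion,
obtained by removing the last letter of a word.

On the Fock side, the last letter `c` turns `Ω_s` into a multiple of some `e_{p,s}(k)`. This vector
has to be annihilated again. Only the letter dual to `c` can do so, and only when the letters in
between have returned to the vacuum `Ω_p`. The moment of `W c` is therefore a sum over the
splittings of `W` at a dual letter, with weight `d_p v_{p,s}(u)` (`wordOp_single_cons`,
`wordMoment_append_block`).

On the matrix side, Gaussian integration by parts (`integral_complex_X_mul`) in the last factor of
the entry `(j, j)` gives the same splittings. The moment of the inner word times `d_p` is replaced
by a partial trace divided by `n` (`IsBlockWick.wordMat_append`). To close the recursion, the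
induction in `tendsto_moment_colorFilter` treats a diagonal entry times any product of such traces,
so asymptotic factorization is part of the statement being proved. When the derivative hits one of
the traces, the result is a diagonal entry of a merged word with an extra factor `1/n`
(`crossTerm_normTrace`), and this disappears in the limit. Merged words contain projections `D_p`,
which is why these count as letters.

Convergence along `colorFilter` is uniform in `j ∈ N_q`. It therefore survives averaging over `N_q`,
and summation with weight `1/n` produces the factor `d_q`, which may be zero. -/

theorem integrable_pow_gaussianReal (σ : ℝ≥0) (a : ℕ) :
    Integrable (fun x : ℝ => x ^ a) (gaussianReal 0 σ) := by
  rcases Nat.eq_zero_or_pos a with rfl | ha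
  · simp
  have h := (memLp_id_gaussianReal (μ := 0) (v := σ) a).integrable_norm_pow ha.ne'
  refine h.mono' (by fun_prop) (Eventually.of_forall fun x => ?_)
  simp

theorem integrable_pow_mul_gaussianPDFReal {σ : ℝ≥0} (hσ : σ ≠ 0) (a : ℕ) :
    Integrable (fun x : ℝ => x ^ a * gaussianPDFReal 0 σ x) := by
  have h := integrable_pow_gaussianReal σ a
  rw [gaussianReal_of_var_ne_zero _ hσ,
    integrable_withDensity_iff_integrable_smul' (measurable_gaussianPDF _ _)
      (Eventually.of_forall fun _ => gaussianPDF_lt_top)] at h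
  refine h.congr (Eventually.of_forall fun x => ?_)
  simp [toReal_gaussianPDF, mul_comm]

theorem hasDerivAt_gaussianPDFReal {σ : ℝ≥0} (hσ : σ ≠ 0) (x : ℝ) :
    HasDerivAt (gaussianPDFReal 0 σ) (-(x / σ) * gaussianPDFReal 0 σ x) x := by
  have hσ' : (σ : ℝ) ≠ 0 := by exact_mod_cast hσ
  have h1 : HasDerivAt (fun y : ℝ => -(y - 0) ^ 2 / (2 * (σ : ℝ))) (-(x / σ)) x := by
    have := (((hasDerivAt_id x).sub_const 0).pow 2).neg.div_const (2 * (σ : ℝ))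
    refine this.congr_deriv ?_
    simp
    field_simp
  have h2 := (h1.exp).const_mul ((Real.sqrt (2 * Real.pi * σ))⁻¹)
  rw [gaussianPDFReal_def]
  refine h2.congr_deriv ?_
  ring

/-- Integration by parts against the density, whose derivative is `-x/σ` times itself. Variance zero
is a point mass without density and is treated separately. For `a = 0` the truncated exponent is
harmless, since its coefficient vanishes. -/
theorem integral_pow_succ_gaussianReal (σ : ℝ≥0) (a : ℕ) :
    ∫ x, x ^ (a + 1) ∂gaussianReal 0 σ = σ * (a * ∫ x, x ^ (a - 1) ∂gaussianReal 0 σ) := by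
  by_cases hσ : σ = 0
  · subst hσ
    simp [gaussianReal_zero_var]
  have hσ' : (σ : ℝ) ≠ 0 := by exact_mod_cast hσ
  rw [integral_gaussianReal_eq_integral_smul hσ, integral_gaussianReal_eq_integral_smul hσ]
  have hI := integrable_pow_mul_gaussianPDFReal hσ
  have key := integral_mul_deriv_eq_deriv_mul_of_integrable
    (u := fun x : ℝ => x ^ a) (u' := fun x : ℝ => a * x ^ (a - 1))
    (v := gaussianPDFReal 0 σ) (v' := fun x => -(x / σ) * gaussianPDFReal 0 σ x)
    (fun x _ => by simpa using hasDerivAt_pow a x)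
    (fun x _ => hasDerivAt_gaussianPDFReal hσ x)
    (((hI (a + 1)).const_mul (-(σ : ℝ)⁻¹)).congr (Eventually.of_forall fun x => by
      simp only [Pi.mul_apply]; field_simp; ring))
    (((hI (a - 1)).const_mul a).congr (Eventually.of_forall fun x => by
      simp only [Pi.mul_apply]; ring))
    (hI a)
  have e1 : ∫ x : ℝ, x ^ a * (-(x / σ) * gaussianPDFReal 0 σ x)
      = -(σ : ℝ)⁻¹ * ∫ x : ℝ, gaussianPDFReal 0 σ x • x ^ (a + 1) := by
    rw [← integral_const_mul]
    congr 1; ext x; simp only [smul_eq_mul]; field_simp; ring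
  have e2 : ∫ x : ℝ, a * x ^ (a - 1) * gaussianPDFReal 0 σ x
      = a * ∫ x : ℝ, gaussianPDFReal 0 σ x • x ^ (a - 1) := by
    rw [← integral_const_mul]
    congr 1; ext x; simp only [smul_eq_mul]; ring
  rw [e1, e2] at key
  rw [← neg_eq_iff_eq_neg.2 key]
  field_simp

section Wick

variable {Ω κ : Type*} [MeasurableSpace Ω] {P : Measure Ω}
  {X : κ → Ω → ℝ} {σ : κ → ℝ≥0}

theorem integrable_eval_of_gaussian [IsProbabilityMeasure P]
    (hlaw : ∀ k, HasLaw (X k) (gaussianReal 0 (σ k)) P) (p : MvPolynomial κ ℂ) :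
    Integrable (fun ω => MvPolynomial.eval (fun k => (X k ω : ℂ)) p) P := by
  have hX : ∀ k (a : ℝ≥0), MemLp (fun ω => (X k ω : ℂ)) a P := fun k a => by
    have h : MemLp (X k) a P := by
      have h0 := memLp_id_gaussianReal (μ := 0) (v := σ k) a
      rw [← (hlaw k).map_eq] at h0
      exact h0.comp_of_map (hlaw k).aemeasurable
    exact h.ofReal
  -- Multiplying by a variable through Hölder's inequality needs exponent `2a` to reach `a`, so the
  -- induction carries all exponents at once.
  have hp : ∀ a : ℝ≥0, MemLp (fun ω => MvPolynomial.eval (fun k => (X k ω : ℂ)) p) a P := by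
    induction p using MvPolynomial.induction_on with
    | C c => intro a; simpa using memLp_const c
    | add p q hp hq => intro a; simp only [map_add]; exact (hp a).add (hq a)
    | mul_X p k hp =>
      intro a
      have : ENNReal.HolderTriple ((2 * a : ℝ≥0) : ENNReal) ((2 * a : ℝ≥0) : ENNReal) a := by
        constructor
        by_cases ha : a = 0
        · simp [ha]
        have h2 : (2 * a : ℝ≥0) ≠ 0 := by positivity
        rw [← ENNReal.coe_inv h2, ← ENNReal.coe_inv ha, ← ENNReal.coe_add]
        congr 1
        field_simp
        norm_num
      simpa [mul_comm] using MemLp.mul' (r := a) (hp (2 * a)) (hX k (2 * a))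
  exact memLp_one_iff_integrable.1 (by simpa using hp 1)

theorem integral_monomial_of_gaussian [Fintype κ]
    (hindep : iIndepFun X P) (hlaw : ∀ k, HasLaw (X k) (gaussianReal 0 (σ k)) P)
    (s : κ →₀ ℕ) (c : ℂ) :
    ∫ ω, MvPolynomial.eval (fun k => (X k ω : ℂ)) (MvPolynomial.monomial s c) ∂P
      = c * ∏ k, ((∫ x, x ^ s k ∂gaussianReal 0 (σ k) : ℝ) : ℂ) := by
  have h : ∀ ω, MvPolynomial.eval (fun k => (X k ω : ℂ)) (MvPolynomial.monomial s c)
      = c * ((∏ k, X k ω ^ s k : ℝ) : ℂ) := fun ω => by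
    rw [MvPolynomial.eval_monomial, Finsupp.prod_fintype _ _ (by simp)]
    push_cast; rfl
  simp_rw [h]
  rw [integral_const_mul, integral_complex_ofReal,
    hindep.integral_fun_prod_comp (f := fun k x => x ^ s k) (fun k => (hlaw k).aemeasurable)
      (fun k => by fun_prop), Complex.ofReal_prod]
  congr 1
  refine Finset.prod_congr rfl fun k _ => ?_
  congr 1
  exact (hlaw k).integral_comp (f := fun x => x ^ s k) (by fun_prop)

/-- By linearity it is enough to take monomials. Independence factors their integrals, and only the
factor at `k` changes, by the one-variable moment recursion. -/
theorem integral_X_mul_of_gaussian [Fintype κ] [IsProbabilityMeasure P]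
    (hindep : iIndepFun X P) (hlaw : ∀ k, HasLaw (X k) (gaussianReal 0 (σ k)) P)
    (k : κ) (p : MvPolynomial κ ℂ) :
    ∫ ω, MvPolynomial.eval (fun k => (X k ω : ℂ)) (MvPolynomial.X k * p) ∂P
      = (σ k : ℂ) * ∫ ω, MvPolynomial.eval (fun k => (X k ω : ℂ)) (MvPolynomial.pderiv k p) ∂P := by
  classical
  induction p using MvPolynomial.induction_on' with
  | monomial s c =>
    have hXm : (MvPolynomial.X k * MvPolynomial.monomial s c : MvPolynomial κ ℂ)
        = MvPolynomial.monomial (Finsupp.single k 1 + s) c := by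
      rw [MvPolynomial.X, MvPolynomial.monomial_mul, one_mul]
    rw [hXm, MvPolynomial.pderiv_monomial, integral_monomial_of_gaussian hindep hlaw,
      integral_monomial_of_gaussian hindep hlaw, ← Finset.mul_prod_erase _ _ (Finset.mem_univ k),
      ← Finset.mul_prod_erase (a := k) _ _ (Finset.mem_univ k)]
    have hrest : ∀ j ∈ Finset.univ.erase k,
        ((∫ x, x ^ (Finsupp.single k 1 + s : κ →₀ ℕ) j ∂gaussianReal 0 (σ j) : ℝ) : ℂ)
          = ((∫ x, x ^ (s - Finsupp.single k 1 : κ →₀ ℕ) j ∂gaussianReal 0 (σ j) : ℝ) : ℂ) := by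
      intro j hj
      have : k ≠ j := (Finset.ne_of_mem_erase hj).symm
      simp [this]
    rw [Finset.prod_congr rfl hrest]
    have hk : (Finsupp.single k 1 + s : κ →₀ ℕ) k = s k + 1 := by simp [add_comm]
    have hk' : (s - Finsupp.single k 1 : κ →₀ ℕ) k = s k - 1 := by simp
    rw [hk, hk', integral_pow_succ_gaussianReal]
    push_cast
    ring
  | add p q hp hq =>
    have hI := integrable_eval_of_gaussian (X := X) (P := P) hlaw
    simp only [mul_add, map_add] at hp hq ⊢
    rw [integral_add (hI _) (hI _), integral_add (hI _) (hI _), hp, hq]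
    ring

/-! ### Circular complex Gaussian variables and Wirtinger derivatives -/

section ComplexWick

/-- The imaginary unit `i` (`false`) or its conjugate (`true`). -/
def conjUnit (ε : Bool) : ℂ := if ε then -Complex.I else Complex.I

theorem conjUnit_mul (ε ε' : Bool) :
    conjUnit ε * conjUnit ε' = if ε' = !ε then 1 else -1 := by
  cases ε <;> cases ε' <;> simp [conjUnit]

variable {S : Type*}

/-- The complex polynomial variable `x + iy` or its conjugate `x - iy`, in terms of the real
variables `x` and `y` attached to a site. -/
def complexVar (k : S × Bool) : MvPolynomial (S × Bool) ℂ :=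
  MvPolynomial.X (k.1, false) + MvPolynomial.C (conjUnit k.2) * MvPolynomial.X (k.1, true)

/-- This is the Wirtinger rule: `∂_x ± i ∂_y` is twice the derivative in the variable of opposite
conjugation type. Both sides obey the Leibniz rule, so only variables need checking. There
`conjUnit_mul` makes equal types cancel and opposite types add up to 2. -/
theorem pderiv_complexVar (s : S) (ε : Bool) (F : MvPolynomial (S × Bool) ℂ) :
    MvPolynomial.pderiv (s, false) (MvPolynomial.aeval complexVar F)
        + MvPolynomial.C (conjUnit ε)
          * MvPolynomial.pderiv (s, true) (MvPolynomial.aeval complexVar F)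
      = 2 * MvPolynomial.aeval complexVar (MvPolynomial.pderiv (s, !ε) F) := by
  classical
  induction F using MvPolynomial.induction_on with
  | C c => simp
  | add p q hp hq =>
    simp only [map_add]
    linear_combination hp + hq
  | mul_X p k hp =>
    obtain ⟨s', ε'⟩ := k
    have hX : MvPolynomial.pderiv (s, false) (complexVar (s', ε'))
        + MvPolynomial.C (conjUnit ε) * MvPolynomial.pderiv (s, true) (complexVar (s', ε'))
        = 2 * MvPolynomial.aeval (complexVar (S := S))
          (MvPolynomial.pderiv (s, !ε) (MvPolynomial.X (s', ε') : MvPolynomial (S × Bool) ℂ)) := by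
      by_cases hs : s' = s
      · subst hs
        simp only [complexVar, map_add, Derivation.leibniz, MvPolynomial.pderiv_C,
          MvPolynomial.pderiv_X, Pi.single_apply, Prod.mk.injEq, smul_eq_mul]
        have hC : (MvPolynomial.C (conjUnit ε) * MvPolynomial.C (conjUnit ε')
            : MvPolynomial (S × Bool) ℂ) = MvPolynomial.C (if ε' = !ε then 1 else -1) := by
          rw [← conjUnit_mul, map_mul]
        by_cases h : ε' = !ε
        · rw [if_pos h] at hC
          simp [h] at hC ⊢
          linear_combination hC
        · rw [if_neg h] at hC
          simp [h] at hC ⊢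
          linear_combination hC
      · simp [complexVar, Derivation.leibniz, MvPolynomial.pderiv_X, hs]
    simp only [map_mul, Derivation.leibniz, MvPolynomial.aeval_X, smul_eq_mul, map_add]
    linear_combination (MvPolynomial.aeval complexVar p : MvPolynomial (S × Bool) ℂ) * hX + complexVar (s', ε') * hp

/-- The value at `ω` of the complex variable (`false`) or its conjugate (`true`) whose real and
imaginary parts are `X (s, false)` and `X (s, true)`. -/
def complexValue (X : S × Bool → Ω → ℝ) (ω : Ω) (k : S × Bool) : ℂ :=
  X (k.1, false) ω + conjUnit k.2 * X (k.1, true) ω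

omit [MeasurableSpace Ω] in
theorem eval_complexValue (X : S × Bool → Ω → ℝ) (ω : Ω) (p : MvPolynomial (S × Bool) ℂ) :
    MvPolynomial.eval (complexValue X ω) p
      = MvPolynomial.eval (fun k => (X k ω : ℂ)) (MvPolynomial.aeval complexVar p) := by
  induction p using MvPolynomial.induction_on with
  | C c => simp
  | add p q hp hq => simp [hp, hq]
  | mul_X p k hp => simp [hp, complexValue, complexVar]

variable [IsProbabilityMeasure P] {X : S × Bool → Ω → ℝ} {σ : S → ℝ≥0}

theorem integrable_eval_complexValue
    (hlaw : ∀ k, HasLaw (X k) (gaussianReal 0 (σ k.1)) P) (p : MvPolynomial (S × Bool) ℂ) :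
    Integrable (fun ω => MvPolynomial.eval (complexValue X ω) p) P := by
  simp_rw [eval_complexValue]
  exact integrable_eval_of_gaussian hlaw _

/-- Integration by parts for circular complex Gaussian variables. -/
theorem integral_complex_X_mul [Fintype S]
    (hindep : iIndepFun X P) (hlaw : ∀ k, HasLaw (X k) (gaussianReal 0 (σ k.1)) P)
    (s : S) (ε : Bool) (p : MvPolynomial (S × Bool) ℂ) :
    ∫ ω, MvPolynomial.eval (complexValue X ω) (MvPolynomial.X (s, ε) * p) ∂P
      = 2 * (σ s : ℂ) * ∫ ω, MvPolynomial.eval (complexValue X ω)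
          (MvPolynomial.pderiv (s, !ε) p) ∂P := by
  have hI := integrable_eval_of_gaussian (X := X) (P := P) (σ := fun k => σ k.1) hlaw
  have h1 := integral_X_mul_of_gaussian hindep (σ := fun k => σ k.1) hlaw (s, false)
    (MvPolynomial.aeval complexVar p)
  have h2 := integral_X_mul_of_gaussian hindep (σ := fun k => σ k.1) hlaw (s, true)
    (MvPolynomial.aeval complexVar p)
  have h3 : ∀ ω, MvPolynomial.eval (complexValue X ω) (MvPolynomial.X (s, ε) * p)
      = MvPolynomial.eval (fun k => (X k ω : ℂ))
          (MvPolynomial.X (s, false) * MvPolynomial.aeval complexVar p)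
        + conjUnit ε * MvPolynomial.eval (fun k => (X k ω : ℂ))
          (MvPolynomial.X (s, true) * MvPolynomial.aeval complexVar p) := fun ω => by
    rw [eval_complexValue]
    simp [complexVar]
    ring
  have h4 : ∀ ω, 2 * MvPolynomial.eval (complexValue X ω) (MvPolynomial.pderiv (s, !ε) p)
      = MvPolynomial.eval (fun k => (X k ω : ℂ))
          (MvPolynomial.pderiv (s, false) (MvPolynomial.aeval complexVar p))
        + conjUnit ε * MvPolynomial.eval (fun k => (X k ω : ℂ))
          (MvPolynomial.pderiv (s, true) (MvPolynomial.aeval complexVar p)) := fun ω => by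
    have := congrArg (MvPolynomial.eval fun k => (X k ω : ℂ)) (pderiv_complexVar s ε p)
    rw [eval_complexValue]
    simpa using this.symm
  have h5 : (2 : ℂ) * ∫ ω, MvPolynomial.eval (complexValue X ω) (MvPolynomial.pderiv (s, !ε) p) ∂P
      = ∫ ω, 2 * MvPolynomial.eval (complexValue X ω) (MvPolynomial.pderiv (s, !ε) p) ∂P :=
    (integral_const_mul _ _).symm
  rw [mul_comm 2 (σ s : ℂ), mul_assoc, h5]
  simp_rw [h3, h4]
  rw [integral_add (hI _) ((hI _).const_mul _), integral_add (hI _) ((hI _).const_mul _),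
    integral_const_mul, integral_const_mul, h1, h2]
  ring

end ComplexWick

end Wick

/-! ### Words in directed block letters and their vacuum moments -/

/-- All ways to write a list as `V ++ x :: W`, recorded as pairs `(V, W)`. -/
def splitsAt {α : Type*} [DecidableEq α] (x : α) : List α → List (List α × List α)
  | [] => []
  | y :: W => (if y = x then [([], W)] else []) ++ (splitsAt x W).map fun s => (y :: s.1, s.2)

theorem eq_of_mem_splitsAt {α : Type*} [DecidableEq α] {x : α} {W : List α}
    {s : List α × List α} (hs : s ∈ splitsAt x W) : W = s.1 ++ x :: s.2 := by
  induction W generalizing s with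
  | nil => simp [splitsAt] at hs
  | cons y W ih =>
    simp only [splitsAt, List.mem_append, List.mem_map] at hs
    rcases hs with hs | ⟨s', hs', rfl⟩
    · split_ifs at hs with hy
      · simp only [List.mem_singleton] at hs
        subst hs hy
        rfl
      · simp at hs
    · simp [← ih hs']

/-- The letter `(u, ε, p, q)` stands for the rectangular block `D_p Y(u)^ε D_q`. -/
abbrev BlockLetter (r t : ℕ) : Type := Fin t × Bool × Fin r × Fin r

/-- A letter is a rectangular block or one of the projections `D_p`. -/
abbrev Letter (r t : ℕ) : Type := BlockLetter r t ⊕ Fin r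

/-- The only block letter that is correlated with a given one. -/
def BlockLetter.dual {r t : ℕ} (c : BlockLetter r t) : BlockLetter r t :=
  (c.1, !c.2.1, c.2.2.2, c.2.2.1)

section Fock

variable {r t : ℕ}

/-- The index `2u - 1` for `ε = 1` and `2u` for `ε = *`. -/
def pairIdx (u : Fin t) (ε : Bool) : Fin (2 * t) := if ε then evenIdx u else oddIdx u

theorem pairIdx_inj {u u' : Fin t} {ε ε' : Bool} :
    pairIdx u ε = pairIdx u' ε' ↔ u = u' ∧ ε = ε' := by
  cases ε <;> cases ε' <;> simp [pairIdx, evenIdx, oddIdx, Fin.ext_iff] <;> omega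

theorem blockCovariance_pairIdx (d : Fin r → ℝ) (v : Fin t → Fin r → Fin r → ℝ≥0) (u : Fin t)
    (ε : Bool) (p q : Fin r) : blockCovariance d v (pairIdx u ε) p q = d p * v u p q := by
  have : (pairIdx u ε).1 / 2 = u.1 := by
    cases ε <;> simp [pairIdx, evenIdx, oddIdx]
    omega
  simp [blockCovariance, this]

/-- The algebraic span of the basis vectors with a given last colour. -/
abbrev Sector (r t : ℕ) : Type := List (Fin r × Fin (2 * t)) →₀ ℂ

theorem headColor_nil (s : Fin r) : headColor (([], s) : FockIndex r (Fin (2 * t))) = s := by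
  rw [headColor]

theorem headColor_cons (a : Fin r × Fin (2 * t)) (l : List (Fin r × Fin (2 * t))) (s : Fin r) :
    headColor ((a :: l, s) : FockIndex r (Fin (2 * t))) = a.1 := by
  rw [headColor]

variable (b : Fin (2 * t) → Fin r → Fin r → ℝ)

/-- Annihilation of the basis vector `l` in the sector of last colour `s`. -/
def annihBasis (s p q : Fin r) (k : Fin (2 * t)) : List (Fin r × Fin (2 * t)) → Sector r t
  | [] => 0
  | a :: l => if a = (p, k) ∧ headColor (l, s) = q then
      Finsupp.single l (Real.sqrt (b k p q) : ℂ) else 0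

/-- The operator of a letter in the sector of last colour `s`, on the basis. -/
def letterBasis (s : Fin r) : Letter r t → List (Fin r × Fin (2 * t)) → Sector r t
  | .inl (u, ε, p, q), l =>
      (if headColor (l, s) = q then
        Finsupp.single ((p, pairIdx u ε) :: l) (Real.sqrt (b (pairIdx u ε) p q) : ℂ) else 0)
      + annihBasis b s q p (pairIdx u !ε) l
  | .inr p, l => if headColor (l, s) = p then Finsupp.single l 1 else 0

/-- The operator of a letter in the sector of last colour `s`. -/
def letterOp (s : Fin r) (a : Letter r t) : Module.End ℂ (Sector r t) :=
  Finsupp.linearCombination ℂ (letterBasis b s a)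

theorem letterOp_single (s : Fin r) (a : Letter r t) (l : List (Fin r × Fin (2 * t))) :
    letterOp b s a (Finsupp.single l 1) = letterBasis b s a l := by
  simp [letterOp]

/-- The operator of a word in the sector of last colour `s`. -/
def wordOp (s : Fin r) (W : List (Letter r t)) : Module.End ℂ (Sector r t) :=
  (W.map (letterOp b s)).prod

/-- The vacuum moment of a word. -/
def wordMoment (s : Fin r) (W : List (Letter r t)) : ℂ := wordOp b s W (Finsupp.single [] 1) []

/-- Tensoring on the right with one basis vector. -/
def appendOne (a : Fin r × Fin (2 * t)) : Sector r t →ₗ[ℂ] Sector r t :=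
  Finsupp.lmapDomain ℂ ℂ fun l => l ++ [a]

theorem appendOne_nil (a : Fin r × Fin (2 * t)) (y : Sector r t) : appendOne a y [] = 0 := by
  simp only [appendOne, Finsupp.lmapDomain_apply]
  exact Finsupp.mapDomain_of_notMem_range _ _ (by simp)

/-- Letters act on the left end of a tensor, and `e_{p,q}(k)` at the right end shows the colour `p`,
just as `Ω_p` would. The two differ only at the vacuum component: `Ω_p` cannot be annihilated, while
`e_{p,q}(k)` is sent to a multiple of `Ω_q` by the dual letter and by no other. -/
theorem letterOp_appendOne (c : BlockLetter r t) (a : Letter r t) (y : Sector r t) :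
    letterOp b c.2.2.2 a (appendOne (c.2.2.1, pairIdx c.1 c.2.1) y)
      = appendOne (c.2.2.1, pairIdx c.1 c.2.1) (letterOp b c.2.2.1 a y)
        + y [] • (if a = .inl c.dual then Finsupp.single []
            (Real.sqrt (b (pairIdx c.1 c.2.1) c.2.2.1 c.2.2.2) : ℂ) else 0) := by
  obtain ⟨u, ε, p, q⟩ := c
  induction y using Finsupp.induction_linear with
  | zero => simp
  | add y z hy hz => simp only [map_add, hy, hz, Finsupp.add_apply, add_smul]; abel
  | single l x =>
    have hx : (Finsupp.single l x : Sector r t) = x • Finsupp.single l 1 := by simp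
    rw [hx]
    simp only [map_smul, Finsupp.smul_apply, smul_assoc, ← smul_add]
    congr 1
    have happ : appendOne (p, pairIdx u ε) (Finsupp.single l 1)
        = Finsupp.single (l ++ [(p, pairIdx u ε)]) (1 : ℂ) := by
      simp [appendOne]
    rw [happ, letterOp_single, letterOp_single]
    rcases a with ⟨u', ε', p', q'⟩ | p'
    · rcases l with _ | ⟨x, l⟩
      · have hd : ((Sum.inl (u', ε', p', q') : Letter r t)
            = .inl (BlockLetter.dual (u, ε, p, q)))
            ↔ ((p, pairIdx u ε) = (q', pairIdx u' !ε') ∧ q = p') := by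
          simp only [BlockLetter.dual, Sum.inl.injEq, Prod.mk.injEq, pairIdx_inj]
          cases ε <;> cases ε' <;> simp <;> tauto
        simp only [letterBasis, annihBasis, List.nil_append, headColor_nil, headColor_cons, hd]
        by_cases h1 : (p, pairIdx u ε) = (q', pairIdx u' !ε') ∧ q = p'
        · obtain ⟨h2, rfl⟩ := h1
          obtain ⟨rfl, h3⟩ := Prod.mk.inj h2
          simp [appendOne, h3]
        · rw [if_neg h1, if_neg h1]
          split_ifs <;> simp [appendOne]
      · have hl : headColor (l ++ [(p, pairIdx u ε)], q) = headColor (l, p) := by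
          cases l <;> rfl
        simp only [letterBasis, annihBasis, List.cons_append, headColor_cons, hl]
        split_ifs <;> simp [appendOne, Finsupp.mapDomain_add]
    · have hl : headColor (l ++ [(p, pairIdx u ε)], q) = headColor (l, p) := by
        cases l <;> rfl
      simp only [letterBasis, hl]
      split_ifs <;> simp_all [appendOne]

/-- Either the initial vector survives to the end, or some dual letter of `W` annihilates it. In the
second case the letters to its right contribute their vacuum moment at the left colour of `c`, and
those to its left act afresh on the vacuum of the right colour. -/
theorem wordOp_single_cons (c : BlockLetter r t) (W : List (Letter r t)) :
    wordOp b c.2.2.2 W (Finsupp.single [(c.2.2.1, pairIdx c.1 c.2.1)] 1)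
      = appendOne (c.2.2.1, pairIdx c.1 c.2.1) (wordOp b c.2.2.1 W (Finsupp.single [] 1))
        + ((splitsAt (.inl c.dual) W).map fun s =>
          ((Real.sqrt (b (pairIdx c.1 c.2.1) c.2.2.1 c.2.2.2) : ℂ) * wordMoment b c.2.2.1 s.2) •
            wordOp b c.2.2.2 s.1 (Finsupp.single [] 1)).sum := by
  induction W with
  | nil => simp [wordOp, splitsAt, appendOne]
  | cons a W ih =>
    have h : ∀ s, wordOp b s (a :: W) = letterOp b s a * wordOp b s W := fun s => by
      simp [wordOp]
    rw [h, h, Module.End.mul_apply, Module.End.mul_apply, ih, map_add, letterOp_appendOne, add_assoc]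
    congr 1
    simp only [splitsAt, List.map_append, List.sum_append, List.map_map]
    congr 1
    · by_cases ha : a = .inl c.dual
      · simp [ha, wordOp, wordMoment, mul_comm]
      · simp [ha]
    · rw [map_list_sum, List.map_map]
      congr 1
      refine List.map_congr_left fun s _ => ?_
      have h' : wordOp b c.2.2.2 (a :: s.1) = letterOp b c.2.2.2 a * wordOp b c.2.2.2 s.1 := by
        simp [wordOp]
      simp [h']

theorem wordMoment_nil (s : Fin r) : wordMoment b s [] = 1 := by simp [wordMoment, wordOp]

theorem wordMoment_append_proj (s p : Fin r) (W : List (Letter r t)) :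
    wordMoment b s (W ++ [.inr p]) = if s = p then wordMoment b s W else 0 := by
  simp only [wordMoment, wordOp, List.map_append, List.prod_append, List.map_cons, List.map_nil,
    List.prod_cons, List.prod_nil, mul_one, Module.End.mul_apply, letterOp_single, letterBasis,
    headColor_nil]
  split_ifs <;> simp

/-- The Fock half of the common recursion. The term in which the created vector survives has no
vacuum component. In the others, the square roots from creation and annihilation multiply to `d_p
v`, which needs `d ≥ 0`. -/
theorem wordMoment_append_block (d : Fin r → ℝ) (hd : ∀ q, 0 ≤ d q)
    (v : Fin t → Fin r → Fin r → ℝ≥0) (s : Fin r)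
    (c : BlockLetter r t) (W : List (Letter r t)) :
    wordMoment (blockCovariance d v) s (W ++ [.inl c])
      = if s = c.2.2.2 then (v c.1 c.2.2.1 s : ℂ) *
          ((splitsAt (.inl c.dual) W).map fun x => wordMoment (blockCovariance d v) s x.1 *
            (d c.2.2.1 * wordMoment (blockCovariance d v) c.2.2.1 x.2)).sum
        else 0 := by
  have h : wordOp (blockCovariance d v) s (W ++ [.inl c])
      = wordOp (blockCovariance d v) s W * letterOp (blockCovariance d v) s (.inl c) := by
    simp [wordOp]
  rw [wordMoment, h, Module.End.mul_apply, letterOp_single]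
  obtain ⟨u, ε, p, q⟩ := c
  simp only [letterBasis, headColor_nil, annihBasis, add_zero]
  split_ifs with hs
  · subst hs
    have hb : (Real.sqrt (blockCovariance d v (pairIdx u ε) p s) : ℂ)
        * Real.sqrt (blockCovariance d v (pairIdx u ε) p s) = d p * v u p s := by
      rw [← Complex.ofReal_mul, Real.mul_self_sqrt] <;> rw [blockCovariance_pairIdx]
      · push_cast; rfl
      · exact mul_nonneg (hd _) (NNReal.coe_nonneg _)
    have key := wordOp_single_cons (blockCovariance d v) (u, ε, p, s) W
    simp only at key
    have hx : ∀ (l : List (Fin r × Fin (2 * t))) (x : ℂ),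
        (Finsupp.single l x : Sector r t) = x • Finsupp.single l 1 := fun l x => by simp
    rw [hx, map_smul, key,
      Finsupp.smul_apply, Finsupp.add_apply, appendOne_nil, zero_add]
    have happ : ∀ L : List (Sector r t), L.sum [] = (L.map fun y => y []).sum := fun L =>
      map_list_sum (Finsupp.applyAddHom (M := ℂ) ([] : List (Fin r × Fin (2 * t)))) L
    rw [happ, List.map_map, smul_eq_mul, ← List.sum_map_mul_left, ← List.sum_map_mul_left]
    congr 1
    refine List.map_congr_left fun x _ => ?_
    simp only [Function.comp_apply, Finsupp.smul_apply, smul_eq_mul, wordMoment]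
    linear_combination (wordOp (blockCovariance d v) p x.2 (Finsupp.single [] 1) []
      * wordOp (blockCovariance d v) s x.1 (Finsupp.single [] 1) []) * hb
  · simp

/-! ### Transfer from the algebraic sectors to bounded operators -/

/-- The embedding of a sector into the Fock space. -/
def sectorEmb (s : Fin r) : Sector r t →ₗ[ℂ] FockSpace r (Fin (2 * t)) :=
  Finsupp.linearCombination ℂ fun l => basisVec (l, s)

theorem inner_basisVec (w : FockIndex r (Fin (2 * t))) (x : FockSpace r (Fin (2 * t))) :
    inner ℂ (basisVec w) x = x w := by
  rw [basisVec, lp.inner_single_left]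
  simp

theorem sectorEmb_single (s : Fin r) (l : List (Fin r × Fin (2 * t))) (x : ℂ) :
    sectorEmb s (Finsupp.single l x) = x • basisVec (l, s) := by
  simp [sectorEmb]

theorem basisVec_apply (w w' : FockIndex r (Fin (2 * t))) :
    (basisVec w : FockSpace r (Fin (2 * t))) w' = if w' = w then 1 else 0 := by
  split_ifs with h
  · simp [basisVec, h]
  · simp [basisVec, h]

theorem inner_vacuum_sectorEmb (s : Fin r) (y : Sector r t) :
    inner ℂ (vacuum s) (sectorEmb s y) = y [] := by
  induction y using Finsupp.induction_linear with
  | zero => simp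
  | add y z hy hz => simp [hy, hz]
  | single l c =>
    rw [vacuum, inner_basisVec]
    by_cases h : l = []
    · simp [sectorEmb, basisVec, h]
    · have h' : (([], s) : FockIndex r (Fin (2 * t))) ≠ (l, s) := by
        simpa using h
      simp [sectorEmb, basisVec, h, h']

theorem adjoint_creation_basisVec (s p q : Fin r) (k : Fin (2 * t))
    (l : List (Fin r × Fin (2 * t))) :
    ContinuousLinearMap.adjoint (creation b p q k) (basisVec (l, s))
      = sectorEmb s (annihBasis b s p q k l) := by
  ext w
  rw [← inner_basisVec, ContinuousLinearMap.adjoint_inner_right, creation_basisVec]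
  rcases l with _ | ⟨a, l⟩
  · split_ifs
    · rw [inner_smul_left, inner_basisVec, basisVec_apply]
      simp [annihBasis, prepend]
    · simp [annihBasis]
  · obtain ⟨l', s'⟩ := w
    have hL : inner ℂ (if headColor (l', s') = q then
          (Real.sqrt (b k p q) : ℂ) • basisVec (prepend p k (l', s')) else 0)
          (basisVec (a :: l, s) : FockSpace r (Fin (2 * t)))
        = if headColor (l', s') = q ∧ (p, k) = a ∧ l' = l ∧ s' = s then
          (Real.sqrt (b k p q) : ℂ) else 0 := by
      by_cases h : headColor (l', s') = q
      · simp [h, inner_basisVec, basisVec_apply, prepend, and_assoc, eq_comm]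
      · simp [h]
    rw [hL]
    simp only [annihBasis]
    by_cases h : a = (p, k) ∧ headColor (l, s) = q
    · rw [if_pos h, sectorEmb_single, lp.coeFn_smul, Pi.smul_apply, basisVec_apply]
      simp only [smul_eq_mul, mul_ite, mul_one, mul_zero, Prod.mk.injEq]
      refine if_congr ⟨fun h' => h'.2.2, ?_⟩ rfl rfl
      rintro ⟨rfl, rfl⟩
      exact ⟨h.2, h.1.symm, rfl, rfl⟩
    · rw [if_neg h, map_zero, if_neg]
      · simp
      · rintro ⟨h1, h2, rfl, rfl⟩
        exact h ⟨h2.symm, h1⟩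

/-- The operator on the Fock space attached to a block letter. -/
def blockOp (c : BlockLetter r t) :
    FockSpace r (Fin (2 * t)) →L[ℂ] FockSpace r (Fin (2 * t)) :=
  creation b c.2.2.1 c.2.2.2 (pairIdx c.1 c.2.1)
    + ContinuousLinearMap.adjoint (creation b c.2.2.2 c.2.2.1 (pairIdx c.1 !c.2.1))

/-- Creation and annihilation at the left end never change the last colour, so each sector is
invariant and moments can be computed algebraically. -/
theorem blockOp_sectorEmb (s : Fin r) (c : BlockLetter r t) (y : Sector r t) :
    blockOp b c (sectorEmb s y) = sectorEmb s (letterOp b s (.inl c) y) := by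
  induction y using Finsupp.induction_linear with
  | zero => simp
  | add y z hy hz => simp [hy, hz]
  | single l x =>
    have hx : (Finsupp.single l x : Sector r t) = x • Finsupp.single l 1 := by simp
    rw [hx]
    simp only [map_smul]
    congr 1
    rw [letterOp_single]
    obtain ⟨u, ε, p, q⟩ := c
    have hl : sectorEmb s (Finsupp.single l 1) = basisVec (l, s) := by simp [sectorEmb]
    rw [hl, blockOp, add_apply, adjoint_creation_basisVec, creation_basisVec]
    simp only [letterBasis, map_add]
    congr 1
    split_ifs <;> simp [sectorEmb, prepend]

theorem vacuumState_prod_blockOp (s : Fin r) (W : List (BlockLetter r t)) :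
    vacuumState s (W.map (blockOp b)).prod = wordMoment b s (W.map .inl) := by
  have h : ∀ y, (W.map (blockOp b)).prod (sectorEmb s y)
      = sectorEmb s (wordOp b s (W.map .inl) y) := by
    induction W with
    | nil => intro y; simp [wordOp]
    | cons c W ih =>
      intro y
      have h' : wordOp b s ((c :: W).map .inl)
          = letterOp b s (.inl c) * wordOp b s (W.map .inl) := by simp [wordOp]
      rw [h', Module.End.mul_apply, ← blockOp_sectorEmb, ← ih]
      simp
  have hv : (vacuum s : FockSpace r (Fin (2 * t))) = sectorEmb s (Finsupp.single [] 1) := by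
    simp [sectorEmb, vacuum]
  rw [vacuumState, wordMoment]
  nth_rw 2 [hv]
  rw [h, inner_vacuum_sectorEmb]

/-- Taking adjoints exchanges the roles of `2u - 1` and `2u`. A block letter pairs creation for `(p,
q)` with annihilation for `(q, p)`, and symmetrization supplies both orders. -/
theorem starPow_eta (d : Fin r → ℝ) (v : Fin t → Fin r → Fin r → ℝ≥0) (p q : Fin r) (u : Fin t)
    (ε : Bool) :
    starPow ε (eta d v p q u)
      = if p = q then blockOp (blockCovariance d v) (u, ε, p, p)
        else blockOp (blockCovariance d v) (u, ε, p, q)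
          + blockOp (blockCovariance d v) (u, ε, q, p) := by
  cases ε <;> by_cases h : p = q <;>
    simp [starPow, eta, blockOp, symCreation, pairIdx, h, star_add,
      ContinuousLinearMap.star_eq_adjoint] <;> abel

end Fock

/-! ### Words in matrices of polynomial variables -/

section Matrices

variable {r t n : ℕ}

/-- Polynomials in the entries of the matrices `Y(u)` and their conjugates. -/
abbrev EntryPoly (t n : ℕ) : Type := MvPolynomial ((Fin t × Fin n × Fin n) × Bool) ℂ

/-- The variable in position `(i, j)` of `Y(u)` or of its adjoint. -/
def entryIdx (u : Fin t) (ε : Bool) (i j : Fin n) : (Fin t × Fin n × Fin n) × Bool :=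
  if ε then ((u, j, i), true) else ((u, i, j), false)

theorem entryIdx_inj {u u' : Fin t} {ε ε' : Bool} {i i' j j' : Fin n} :
    entryIdx u ε i j = entryIdx u' ε' i' j' ↔ u = u' ∧ ε = ε' ∧ i = i' ∧ j = j' := by
  cases ε <;> cases ε' <;> simp [entryIdx]; tauto

/-- The matrix of a letter. -/
def letterMat (N : Fin r → Finset (Fin n)) : Letter r t → Matrix (Fin n) (Fin n) (EntryPoly t n)
  | .inl (u, ε, p, q) => Matrix.of fun i j =>
      if i ∈ N p ∧ j ∈ N q then MvPolynomial.X (entryIdx u ε i j) else 0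
  | .inr p => Matrix.diagonal fun i => if i ∈ N p then 1 else 0

/-- The matrix of a word. -/
def wordMat (N : Fin r → Finset (Fin n)) (W : List (Letter r t)) :
    Matrix (Fin n) (Fin n) (EntryPoly t n) :=
  (W.map (letterMat N)).prod

theorem wordMat_nil (N : Fin r → Finset (Fin n)) : wordMat (t := t) N [] = 1 := by
  simp [wordMat]

theorem wordMat_cons (N : Fin r → Finset (Fin n)) (a : Letter r t) (W : List (Letter r t)) :
    wordMat N (a :: W) = letterMat N a * wordMat N W := by
  simp [wordMat]

theorem wordMat_append (N : Fin r → Finset (Fin n)) (V W : List (Letter r t)) :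
    wordMat N (V ++ W) = wordMat N V * wordMat N W := by
  simp [wordMat]

theorem wordMat_append_proj_cons (N : Fin r → Finset (Fin n)) (p : Fin r)
    (V W : List (Letter r t)) (i j : Fin n) :
    wordMat N (V ++ .inr p :: W) i j = ∑ k ∈ N p, wordMat N V i k * wordMat N W k j := by
  rw [wordMat_append, wordMat_cons, Matrix.mul_apply, ← Finset.sum_subset (Finset.subset_univ (N p))]
  · refine Finset.sum_congr rfl fun k hk => ?_
    simp [letterMat, hk]
  · intro k _ hk
    simp [letterMat, hk]

variable {N : Fin r → Finset (Fin n)} (hN : Pairwise fun p q => Disjoint (N p) (N q))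
include hN

theorem eq_of_mem_of_mem {p q : Fin r} {i : Fin n} (hp : i ∈ N p) (hq : i ∈ N q) : p = q := by
  by_contra h
  exact Finset.disjoint_left.1 (hN h) hp hq

/-- Disjointness makes the position `(i₀, j₀)` determine its two colours, so exactly one block
letter contains the variable. -/
theorem pderiv_letterMat {u : Fin t} {ε : Bool} {p q : Fin r} {i₀ j₀ : Fin n}
    (hi : i₀ ∈ N p) (hj : j₀ ∈ N q) (a : Letter r t) (i j : Fin n) :
    MvPolynomial.pderiv (entryIdx u ε i₀ j₀) (letterMat N a i j)
      = if a = .inl (u, ε, p, q) then (if i = i₀ ∧ j = j₀ then 1 else 0) else 0 := by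
  rcases a with ⟨u', ε', p', q'⟩ | p'
  · simp only [letterMat, Matrix.of_apply]
    by_cases h : i ∈ N p' ∧ j ∈ N q'
    · rw [if_pos h, MvPolynomial.pderiv_X, Pi.single_apply]
      by_cases h2 : entryIdx u ε i₀ j₀ = entryIdx u' ε' i j
      · rw [if_pos h2.symm]
        obtain ⟨rfl, rfl, rfl, rfl⟩ := entryIdx_inj.1 h2
        rw [eq_of_mem_of_mem hN hi h.1, eq_of_mem_of_mem hN hj h.2]
        simp
      · rw [if_neg (Ne.symm h2)]
        split_ifs with h3 h4
        · exfalso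
          apply h2
          simp only [Sum.inl.injEq, Prod.mk.injEq] at h3
          rw [entryIdx_inj]
          exact ⟨h3.1.symm, h3.2.1.symm, h4.1.symm, h4.2.symm⟩
        · rfl
        · rfl
    · rw [if_neg h, map_zero]
      split_ifs with h3 h4
      · exfalso
        simp only [Sum.inl.injEq, Prod.mk.injEq] at h3
        apply h
        rw [h3.2.2.1, h3.2.2.2, h4.1, h4.2]
        exact ⟨hi, hj⟩
      · rfl
      · rfl
  · simp only [letterMat, Matrix.diagonal_apply]
    split_ifs <;> simp_all

/-- By the Leibniz rule, each occurrence of the letter is replaced by a matrix unit, which cuts the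
word in two. -/
theorem pderiv_wordMat {u : Fin t} {ε : Bool} {p q : Fin r} {i₀ j₀ : Fin n}
    (hi : i₀ ∈ N p) (hj : j₀ ∈ N q) (W : List (Letter r t)) (i j : Fin n) :
    MvPolynomial.pderiv (entryIdx u ε i₀ j₀) (wordMat N W i j)
      = ((splitsAt (.inl (u, ε, p, q)) W).map fun s =>
          wordMat N s.1 i i₀ * wordMat N s.2 j₀ j).sum := by
  induction W generalizing i with
  | nil =>
    simp only [wordMat_nil, Matrix.one_apply, splitsAt]
    split_ifs <;> simp
  | cons a W ih =>
    rw [wordMat_cons, Matrix.mul_apply, map_sum]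
    simp only [Derivation.leibniz, smul_eq_mul, ih, pderiv_letterMat hN hi hj,
      Finset.sum_add_distrib, splitsAt, List.map_append, List.sum_append, List.map_map]
    rw [add_comm]
    congr 1
    · by_cases ha : a = .inl (u, ε, p, q)
      · by_cases h : i = i₀
        · simp [ha, h, wordMat_nil]
        · simp [ha, h, wordMat_nil]
      · simp [ha]
    · have h : ∀ s : List (Letter r t) × List (Letter r t),
          wordMat N (a :: s.1) i i₀ * wordMat N s.2 j₀ j
            = ∑ k, letterMat N a i k * (wordMat N s.1 k i₀ * wordMat N s.2 j₀ j) := fun s => by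
        rw [wordMat_cons, Matrix.mul_apply, Finset.sum_mul]
        simp only [mul_assoc]
      simp only [Function.comp_def, h]
      generalize splitsAt (Sum.inl (u, ε, p, q)) W = L
      induction L with
      | nil => simp
      | cons s L ihL => simp only [List.map_cons, List.sum_cons, mul_add, Finset.sum_add_distrib, ihL]

omit hN

/-! ### Normalized traces and integration by parts for words -/

/-- The trace over the coordinates of colour `p`, normalized by the size of the matrix. -/
def normTrace (N : Fin r → Finset (Fin n)) (p : Fin r) (W : List (Letter r t)) : EntryPoly t n :=
  (n : ℂ)⁻¹ • ∑ k ∈ N p, wordMat N W k k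

/-- The part of integration by parts in which the last letter of the word `W` followed by the
block letter `c` is paired with a variable of `F`. -/
def crossTerm (N : Fin r → Finset (Fin n)) (c : BlockLetter r t) (W : List (Letter r t))
    (j : Fin n) (F : EntryPoly t n) : EntryPoly t n :=
  ∑ k ∈ N c.2.2.1, wordMat N W j k * MvPolynomial.pderiv (entryIdx c.1 (!c.2.1) j k) F

theorem crossTerm_mul (N : Fin r → Finset (Fin n)) (c : BlockLetter r t) (W : List (Letter r t))
    (j : Fin n) (F G : EntryPoly t n) :
    crossTerm N c W j (F * G) = crossTerm N c W j F * G + F * crossTerm N c W j G := by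
  simp only [crossTerm, Finset.sum_mul, Finset.mul_sum, ← Finset.sum_add_distrib,
    Derivation.leibniz, smul_eq_mul]
  refine Finset.sum_congr rfl fun k _ => ?_
  ring

theorem crossTerm_one (N : Fin r → Finset (Fin n)) (c : BlockLetter r t) (W : List (Letter r t))
    (j : Fin n) : crossTerm N c W j 1 = 0 := by
  simp [crossTerm]

theorem sum_list_sum_comm {ι α M : Type*} [AddCommMonoid M] (s : Finset ι) (L : List α)
    (f : ι → α → M) :
    ∑ k ∈ s, (L.map fun a => f k a).sum = (L.map fun a => ∑ k ∈ s, f k a).sum := by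
  induction L with
  | nil => simp
  | cons a L ih => simp [Finset.sum_add_distrib, ih]

-- Differentiating a trace opens the cyclic word at a dual letter, leaving `s.2 D_p s.1`. Joined to
-- `W`, this becomes one longer word: the two index sums restricted to colour classes are absorbed
-- by the projection letters, and the trace normalization `1/n` remains in front.
include hN in
theorem crossTerm_normTrace (c : BlockLetter r t) (W V : List (Letter r t)) (p : Fin r)
    {j : Fin n} (hj : j ∈ N c.2.2.2) :
    crossTerm N c W j (normTrace N p V)
      = (n : ℂ)⁻¹ • ((splitsAt (.inl c.dual) V).map fun s =>
          wordMat N (W ++ .inr c.2.2.1 :: (s.2 ++ .inr p :: s.1)) j j).sum := by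
  obtain ⟨u, ε, p', q⟩ := c
  simp only [crossTerm, normTrace, Derivation.map_smul, map_sum, mul_smul_comm,
    ← Finset.smul_sum]
  congr 1
  have h : ∀ k ∈ N p', wordMat N W j k * ∑ l ∈ N p,
      MvPolynomial.pderiv (entryIdx u (!ε) j k) (wordMat N V l l)
      = ((splitsAt (.inl (BlockLetter.dual (u, ε, p', q))) V).map fun s =>
        wordMat N W j k * wordMat N (s.2 ++ .inr p :: s.1) k j).sum := fun k hk => by
    simp only [pderiv_wordMat hN hj hk, BlockLetter.dual]
    rw [sum_list_sum_comm, ← List.sum_map_mul_left]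
    congr 1
    refine List.map_congr_left fun s _ => ?_
    rw [wordMat_append_proj_cons]
    congr 1
    exact Finset.sum_congr rfl fun l _ => mul_comm _ _
  rw [Finset.sum_congr rfl h, sum_list_sum_comm]
  congr 1
  refine List.map_congr_left fun s _ => ?_
  rw [wordMat_append_proj_cons]

/-- The integration by parts formula for a functional on polynomials in the entries. -/
def IsBlockWick (N : Fin r → Finset (Fin n)) (v : Fin t → Fin r → Fin r → ℝ≥0)
    (L : EntryPoly t n →ₗ[ℂ] ℂ) : Prop :=
  ∀ (u : Fin t) (ε : Bool) (p q : Fin r) (i j : Fin n), i ∈ N p → j ∈ N q →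
    ∀ F, L (MvPolynomial.X (entryIdx u ε i j) * F)
      = (v u p q : ℂ) / n * L (MvPolynomial.pderiv (entryIdx u (!ε) j i) F)

-- The matrix half of the common recursion. The last factor is the variable at `(k, j)`. A
-- derivative falling on the word leaves the entries `(j, j)` and `(k, k)` of its two pieces, and
-- the sum over `k` with the covariance's `1/n` is a normalized trace. The derivative of `F` is kept
-- as `crossTerm`.
include hN in
theorem IsBlockWick.wordMat_append {v : Fin t → Fin r → Fin r → ℝ≥0} {L : EntryPoly t n →ₗ[ℂ] ℂ}
    (hL : IsBlockWick N v L) (c : BlockLetter r t) (W : List (Letter r t)) {j : Fin n}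
    (hj : j ∈ N c.2.2.2) (F : EntryPoly t n) :
    L (wordMat N (W ++ [.inl c]) j j * F)
      = (v c.1 c.2.2.1 c.2.2.2 : ℂ) * ((splitsAt (.inl c.dual) W).map fun s =>
          L (wordMat N s.1 j j * (normTrace N c.2.2.1 s.2 * F))).sum
        + (v c.1 c.2.2.1 c.2.2.2 : ℂ) / n * L (crossTerm N c W j F) := by
  obtain ⟨u, ε, p, q⟩ := c
  simp only at hj ⊢
  have h1 : wordMat N (W ++ [.inl (u, ε, p, q)]) j j * F
      = ∑ k ∈ N p, MvPolynomial.X (entryIdx u ε k j) * (wordMat N W j k * F) := by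
    rw [MatricialFock.wordMat_append, wordMat_cons, wordMat_nil, mul_one, Matrix.mul_apply,
      ← Finset.sum_subset (Finset.subset_univ (N p)), Finset.sum_mul]
    · refine Finset.sum_congr rfl fun k hk => ?_
      simp [letterMat, hk, hj]
      ring
    · intro k _ hk
      simp [letterMat, hk]
  have h2 : ∀ k ∈ N p, L (MvPolynomial.X (entryIdx u ε k j) * (wordMat N W j k * F))
      = (v u p q : ℂ) / n * (((splitsAt (.inl (BlockLetter.dual (u, ε, p, q))) W).map fun s =>
          L (wordMat N s.1 j j * wordMat N s.2 k k * F)).sum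
        + L (wordMat N W j k * MvPolynomial.pderiv (entryIdx u (!ε) j k) F)) := fun k hk => by
    rw [hL u ε p q k j hk hj, Derivation.leibniz, pderiv_wordMat hN hj hk, map_add, add_comm,
      smul_eq_mul, smul_eq_mul, mul_comm F, ← List.sum_map_mul_right, map_list_sum, List.map_map]
    rfl
  rw [h1, map_sum, Finset.sum_congr rfl h2, ← Finset.mul_sum, Finset.sum_add_distrib, mul_add,
    sum_list_sum_comm, crossTerm, map_sum]
  congr 1
  rw [div_eq_mul_inv, mul_assoc, ← List.sum_map_mul_left]
  congr 2
  refine List.map_congr_left fun s _ => ?_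
  rw [normTrace, smul_mul_assoc, mul_smul_comm, map_smul, smul_eq_mul]
  congr 1
  rw [Finset.sum_mul, Finset.mul_sum, map_sum]
  simp only [mul_assoc]

end Matrices

/-! ### The limit of mixed moments of words -/

section Limit

variable {r t : ℕ}

/-- The weight by which words are compared in the recursion for their moments. -/
def wordWeight (W : List (Letter r t)) : ℕ := (W.map (Sum.elim (fun _ => 2) fun _ => 1)).sum

theorem wordWeight_append (V W : List (Letter r t)) :
    wordWeight (V ++ W) = wordWeight V + wordWeight W := by
  simp [wordWeight]

theorem wordWeight_inl_cons (c : BlockLetter r t) (W : List (Letter r t)) :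
    wordWeight (.inl c :: W) = 2 + wordWeight W := by
  simp [wordWeight]

theorem wordWeight_inr_cons (p : Fin r) (W : List (Letter r t)) :
    wordWeight (.inr p :: W) = 1 + wordWeight W := by
  simp [wordWeight]

theorem wordWeight_nil : wordWeight ([] : List (Letter r t)) = 0 := by
  simp [wordWeight]

/-- The weight of a product of traces of words. -/
def traceWeight (G : List (Fin r × List (Letter r t))) : ℕ :=
  (G.map fun g => wordWeight g.2 + 1).sum

/-- A product of normalized traces of words. -/
def traceProd {n : ℕ} (N : Fin r → Finset (Fin n)) (G : List (Fin r × List (Letter r t))) :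
    EntryPoly t n :=
  (G.map fun g => normTrace N g.1 g.2).prod

/-- The limit of a product of normalized traces of words. -/
def traceLimit (d : Fin r → ℝ) (v : Fin t → Fin r → Fin r → ℝ≥0)
    (G : List (Fin r × List (Letter r t))) : ℂ :=
  (G.map fun g => (d g.1 : ℂ) * wordMoment (blockCovariance d v) g.1 g.2).prod

/-! ### Convergence uniform over a colour class -/

/-- The filter of positions `(n, j)` with `j ∈ N_q` and `n → ∞`. -/
def colorFilter (N : (n : ℕ) → Fin r → Finset (Fin n)) (q : Fin r) : Filter (Σ n, Fin n) :=
  comap Sigma.fst atTop ⊓ 𝓟 {x | x.2 ∈ N x.1 q}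

variable {N : (n : ℕ) → Fin r → Finset (Fin n)}

theorem tendsto_fst_colorFilter (q : Fin r) : Tendsto Sigma.fst (colorFilter N q) atTop :=
  tendsto_comap.mono_left inf_le_left

theorem eventually_mem_colorFilter (q : Fin r) : ∀ᶠ x in colorFilter N q, x.2 ∈ N x.1 q :=
  mem_inf_of_right (mem_principal_self _)

theorem tendsto_average_colorFilter {q : Fin r} (hN_ne : ∀ᶠ n in atTop, (N n q).Nonempty)
    {g : (Σ n, Fin n) → ℂ} {a : ℂ} (hg : Tendsto g (colorFilter N q) (𝓝 a)) :
    Tendsto (fun n => (∑ j ∈ N n q, g ⟨n, j⟩) / ((N n q).card : ℂ)) atTop (𝓝 a) := by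
  rw [Metric.tendsto_nhds]
  intro δ hδ
  have h := (Metric.tendsto_nhds.1 hg) (δ / 2) (by positivity)
  rw [colorFilter, eventually_inf_principal, eventually_comap] at h
  filter_upwards [h, hN_ne] with n hn hne
  have hc : (0 : ℝ) < (N n q).card := by exact_mod_cast hne.card_pos
  have hc' : ((N n q).card : ℂ) ≠ 0 := by exact_mod_cast hc.ne'
  have e : (∑ j ∈ N n q, g ⟨n, j⟩) / ((N n q).card : ℂ) - a
      = (∑ j ∈ N n q, (g ⟨n, j⟩ - a)) / ((N n q).card : ℂ) := by
    rw [Finset.sum_sub_distrib, Finset.sum_const, nsmul_eq_mul]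
    field_simp
  rw [dist_eq_norm, e, norm_div, Complex.norm_natCast]
  have hb : ‖∑ j ∈ N n q, (g ⟨n, j⟩ - a)‖ ≤ (N n q).card * (δ / 2) := by
    refine (norm_sum_le _ _).trans ((Finset.sum_le_card_nsmul _ _ (δ / 2) fun j hj => ?_).trans_eq
      (nsmul_eq_mul _ _))
    have := hn ⟨n, j⟩ rfl hj
    rw [dist_eq_norm] at this
    exact this.le
  calc _ ≤ (N n q).card * (δ / 2) / (N n q).card := by gcongr
    _ = δ / 2 := by field_simp
    _ < δ := by linarith

/-- The sum is the average over `N_q` times `|N_q|/n`. This is the source of the factor `d_p` in the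
covariances. -/
theorem tendsto_sum_colorFilter {q : Fin r} (hN_ne : ∀ᶠ n in atTop, (N n q).Nonempty) {d : ℝ}
    (hd : Tendsto (fun n : ℕ => ((N n q).card : ℝ) / (n : ℝ)) atTop (𝓝 d))
    {g : (Σ n, Fin n) → ℂ} {a : ℂ} (hg : Tendsto g (colorFilter N q) (𝓝 a)) :
    Tendsto (fun n : ℕ => (n : ℂ)⁻¹ * ∑ j ∈ N n q, g ⟨n, j⟩) atTop (𝓝 (d * a)) := by
  have hd' : Tendsto (fun n : ℕ => (((N n q).card : ℝ) / (n : ℝ) : ℂ)) atTop (𝓝 (d : ℂ)) := by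
    have := (Complex.continuous_ofReal.tendsto d).comp hd
    refine this.congr fun n => ?_
    simp
  refine (hd'.mul (tendsto_average_colorFilter hN_ne hg)).congr' ?_
  filter_upwards [hN_ne] with n hne
  have hc' : ((N n q).card : ℂ) ≠ 0 := by exact_mod_cast hne.card_pos.ne'
  push_cast
  field_simp

/-- Comparison of the two recursions. The factor `traceProd` makes the statement stable under
integration by parts, and uniformity in the position lets a trace be replaced by a diagonal entry
once `W` is empty. -/
theorem tendsto_moment_colorFilter
    (hN_disj : ∀ n, Pairwise fun p q => Disjoint (N n p) (N n q))
    (hN_ne : ∀ᶠ n in atTop, ∀ q, (N n q).Nonempty)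
    {d : Fin r → ℝ} (hd₀ : ∀ q, 0 ≤ d q)
    (hd : ∀ q, Tendsto (fun n : ℕ => ((N n q).card : ℝ) / (n : ℝ)) atTop (𝓝 (d q)))
    {v : Fin t → Fin r → Fin r → ℝ≥0}
    {L : (n : ℕ) → EntryPoly t n →ₗ[ℂ] ℂ} (hL₁ : ∀ n, L n 1 = 1)
    (hL : ∀ n, IsBlockWick (N n) v (L n))
    (W : List (Letter r t)) (G : List (Fin r × List (Letter r t))) (q : Fin r) :
    Tendsto (fun x : Σ n, Fin n => L x.1 (wordMat (N x.1) W x.2 x.2 * traceProd (N x.1) G))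
      (colorFilter N q) (𝓝 (wordMoment (blockCovariance d v) q W * traceLimit d v G)) := by
  -- Splitting `W` trades two block letters for one trace. A cross term removes two block letters
  -- and one trace and adds two projections. Opening a trace when `W` is empty saves its extra 1.
  -- The weight drops each time.
  induction h : wordWeight W + traceWeight G using Nat.strong_induction_on generalizing W G q with
  | _ M ih =>
  subst h
  rcases List.eq_nil_or_concat' W with rfl | ⟨W, a, rfl⟩
  · rcases G with _ | ⟨⟨p, V⟩, G⟩
    · simpa [wordMat_nil, traceProd, traceLimit, wordMoment_nil, hL₁] using tendsto_const_nhds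
    · have h1 := ih _ (by simp [wordWeight_nil, traceWeight]) V G p rfl
      have h2 := (tendsto_sum_colorFilter (hN_ne.mono fun _ h => h p) (hd p) h1).comp
        (tendsto_fst_colorFilter (N := N) q)
      have e : wordMoment (blockCovariance d v) q [] * traceLimit d v ((p, V) :: G)
          = d p * (wordMoment (blockCovariance d v) p V * traceLimit d v G) := by
        simp [wordMoment_nil, traceLimit, mul_assoc]
      rw [e]
      refine h2.congr fun x => ?_
      simp [wordMat_nil, traceProd, normTrace, Finset.sum_mul]
  · rcases a with c | p
    · rw [wordMoment_append_block d hd₀]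
      split_ifs with hq
      · subst hq
        have hmain : Tendsto (fun x : Σ n, Fin n => (v c.1 c.2.2.1 c.2.2.2 : ℂ) *
            ((splitsAt (.inl c.dual) W).map fun s =>
              L x.1 (wordMat (N x.1) s.1 x.2 x.2
                * (normTrace (N x.1) c.2.2.1 s.2 * traceProd (N x.1) G))).sum)
            (colorFilter N c.2.2.2)
            (𝓝 ((v c.1 c.2.2.1 c.2.2.2 : ℂ) * ((splitsAt (.inl c.dual) W).map fun s =>
              wordMoment (blockCovariance d v) c.2.2.2 s.1 * (((d c.2.2.1 : ℂ)
                * wordMoment (blockCovariance d v) c.2.2.1 s.2) * traceLimit d v G)).sum)) := by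
          refine Tendsto.const_mul _ (tendsto_list_sum _ fun s hs => ?_)
          have hW := congrArg wordWeight (eq_of_mem_splitsAt hs)
          have := ih _ (by
            simp only [wordWeight_append, wordWeight_inl_cons,
              wordWeight_nil, traceWeight, List.map_cons, List.sum_cons] at hW ⊢
            omega) s.1 ((c.2.2.1, s.2) :: G) c.2.2.2 rfl
          simpa [traceProd, traceLimit] using this
        -- Only the traces of `G₁` are differentiated. Those of `G₂` are spectators, so the Leibniz
        -- rule becomes an induction on `G₁`.
        have hcross : ∀ G₁ G₂ : List (Fin r × List (Letter r t)),
            traceWeight G₁ + traceWeight G₂ ≤ traceWeight G →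
            Tendsto (fun x : Σ n, Fin n => (v c.1 c.2.2.1 c.2.2.2 : ℂ) / (x.1 : ℂ)
              * L x.1 (crossTerm (N x.1) c W x.2 (traceProd (N x.1) G₁)
                * traceProd (N x.1) G₂)) (colorFilter N c.2.2.2) (𝓝 0) := by
          intro G₁
          induction G₁ with
          | nil =>
            intro G₂ _
            simpa [traceProd, crossTerm_one] using tendsto_const_nhds
          | cons g G₁ ihG =>
            intro G₂ hG
            have hG' : wordWeight g.2 + 1 + traceWeight G₁ + traceWeight G₂ ≤ traceWeight G := by
              simpa [traceWeight] using hG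
            -- The derivative misses `g`, which joins the spectators.
            have t2 := ihG (g :: G₂) (by simp [traceWeight] at hG' ⊢; omega)
            have hinv : Tendsto (fun x : Σ n, Fin n => ((x.1 : ℂ))⁻¹)
                (colorFilter N c.2.2.2) (𝓝 0) :=
              tendsto_inv_atTop_nhds_zero_nat.comp (tendsto_fst_colorFilter c.2.2.2)
            -- The derivative hits `g`. One factor `1/n` is the covariance and the other the
            -- normalization of the trace, while the merged words have convergent moments by the
            -- outer induction.
            have t1 := ((hinv.const_mul (v c.1 c.2.2.1 c.2.2.2 : ℂ)).mul hinv).mul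
              (tendsto_list_sum (splitsAt (.inl c.dual) g.2)
                (f := fun s (x : Σ n, Fin n) => L x.1 (wordMat (N x.1)
                  (W ++ .inr c.2.2.1 :: (s.2 ++ .inr g.1 :: s.1)) x.2 x.2
                    * traceProd (N x.1) (G₁ ++ G₂)))
                (x := colorFilter N c.2.2.2) fun s hs => by
                have hW := congrArg wordWeight (eq_of_mem_splitsAt hs)
                refine ih _ ?_ (W ++ .inr c.2.2.1 :: (s.2 ++ .inr g.1 :: s.1)) (G₁ ++ G₂)
                  c.2.2.2 rfl
                simp only [wordWeight_append, wordWeight_inl_cons,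
                  wordWeight_inr_cons, wordWeight_nil, traceWeight, List.map_append,
                  List.sum_append] at hW hG' ⊢
                omega)
            have t3 := t1.add t2
            simp only [mul_zero, zero_mul, add_zero] at t3
            refine t3.congr' ?_
            filter_upwards [eventually_mem_colorFilter (N := N) c.2.2.2] with x hx
            have e1 : traceProd (N x.1) (g :: G₁)
                = normTrace (N x.1) g.1 g.2 * traceProd (N x.1) G₁ := by simp [traceProd]
            have e2 : traceProd (N x.1) (g :: G₂)
                = normTrace (N x.1) g.1 g.2 * traceProd (N x.1) G₂ := by simp [traceProd]
            have e3 : traceProd (N x.1) (G₁ ++ G₂)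
                = traceProd (N x.1) G₁ * traceProd (N x.1) G₂ := by simp [traceProd]
            have e4 : (x.1 : ℂ)⁻¹ * ((splitsAt (.inl c.dual) g.2).map fun s =>
                L x.1 (wordMat (N x.1) (W ++ .inr c.2.2.1 :: (s.2 ++ .inr g.1 :: s.1)) x.2 x.2
                    * traceProd (N x.1) (G₁ ++ G₂))).sum
                = L x.1 (crossTerm (N x.1) c W x.2 (normTrace (N x.1) g.1 g.2)
                    * traceProd (N x.1) (G₁ ++ G₂)) := by
              rw [crossTerm_normTrace (hN_disj x.1) c W g.2 g.1 hx, smul_mul_assoc, map_smul,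
                smul_eq_mul, ← List.sum_map_mul_right, map_list_sum, List.map_map]
              rfl
            rw [mul_assoc, e4, e1, crossTerm_mul, e2, e3, div_eq_mul_inv, ← mul_add, ← map_add]
            congr 2
            ring
        have hall := hmain.add (hcross G [] (by simp [traceWeight]))
        have e : (v c.1 c.2.2.1 c.2.2.2 : ℂ) * ((splitsAt (.inl c.dual) W).map fun s =>
              wordMoment (blockCovariance d v) c.2.2.2 s.1 * (((d c.2.2.1 : ℂ)
                * wordMoment (blockCovariance d v) c.2.2.1 s.2) * traceLimit d v G)).sum + 0
            = (v c.1 c.2.2.1 c.2.2.2 : ℂ) * ((splitsAt (.inl c.dual) W).map fun s =>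
              wordMoment (blockCovariance d v) c.2.2.2 s.1 * ((d c.2.2.1 : ℂ)
                * wordMoment (blockCovariance d v) c.2.2.1 s.2)).sum * traceLimit d v G := by
          rw [add_zero, mul_assoc, ← List.sum_map_mul_right]
          simp only [mul_assoc]
        rw [e] at hall
        refine hall.congr' ?_
        filter_upwards [eventually_mem_colorFilter (N := N) c.2.2.2] with x hx
        rw [(hL x.1).wordMat_append (hN_disj x.1) c W hx]
        simp [traceProd]
      -- The last letter does not end in the colour of `j`, so its column `j` is zero.
      · rw [zero_mul]
        refine tendsto_const_nhds.congr' ?_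
        filter_upwards [eventually_mem_colorFilter (N := N) q] with x hx
        have : x.2 ∉ N x.1 c.2.2.2 := fun h' => hq (eq_of_mem_of_mem (hN_disj x.1) hx h')
        rw [wordMat_append, wordMat_cons, wordMat_nil, mul_one,
          Matrix.mul_apply]
        simp [letterMat, this]
    · rw [wordMoment_append_proj]
      split_ifs with hq
      · subst hq
        refine (ih _ ?_ W G q rfl).congr' ?_
        · simp only [wordWeight_append, wordWeight_inr_cons, wordWeight_nil]
          omega
        · filter_upwards [eventually_mem_colorFilter (N := N) q] with x hx
          rw [wordMat_append, wordMat_cons, wordMat_nil, mul_one, Matrix.mul_apply]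
          simp [letterMat, Matrix.diagonal_apply, hx]
      · rw [zero_mul]
        refine tendsto_const_nhds.congr' ?_
        filter_upwards [eventually_mem_colorFilter (N := N) q] with x hx
        have : x.2 ∉ N x.1 p := fun h' => hq (eq_of_mem_of_mem (hN_disj x.1) hx h')
        rw [wordMat_append, wordMat_cons, wordMat_nil, mul_one, Matrix.mul_apply]
        simp [letterMat, Matrix.diagonal_apply, this]

end Limit

/-! ### Symmetric blocks of Gaussian matrices -/

section SymBlocks

variable {r t : ℕ}

/-- The matrix of polynomial variables of a symmetric block. -/
def symMat {n : ℕ} (N : Fin r → Finset (Fin n)) (c : BlockLetter r t) :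
    Matrix (Fin n) (Fin n) (EntryPoly t n) :=
  if c.2.2.1 = c.2.2.2 then letterMat N (.inl c)
  else letterMat N (.inl c) + letterMat N (.inl (c.1, c.2.1, c.2.2.2, c.2.2.1))

/-- The Fock space operator of a symmetric block. -/
def symOp (b : Fin (2 * t) → Fin r → Fin r → ℝ) (c : BlockLetter r t) :
    FockSpace r (Fin (2 * t)) →L[ℂ] FockSpace r (Fin (2 * t)) :=
  if c.2.2.1 = c.2.2.2 then blockOp b c
  else blockOp b c + blockOp b (c.1, c.2.1, c.2.2.2, c.2.2.1)

theorem starPow_eta_eq_symOp (d : Fin r → ℝ) (v : Fin t → Fin r → Fin r → ℝ≥0) (p q : Fin r)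
    (u : Fin t) (ε : Bool) :
    starPow ε (eta d v p q u) = symOp (blockCovariance d v) (u, ε, p, q) := by
  rw [starPow_eta, symOp]
  split_ifs with h <;> simp_all

theorem vacuumState_add (q : Fin r)
    (a b : FockSpace r (Fin (2 * t)) →L[ℂ] FockSpace r (Fin (2 * t))) :
    vacuumState q (a + b) = vacuumState q a + vacuumState q b := by
  simp [vacuumState]

theorem blockProj_mul_mul_apply {n : ℕ} (S S' : Finset (Fin n)) (A : Matrix (Fin n) (Fin n) ℂ)
    (i j : Fin n) :
    (blockProj S * A * blockProj S') i j = if i ∈ S ∧ j ∈ S' then A i j else 0 := by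
  rw [blockProj, blockProj, Matrix.mul_diagonal, Matrix.diagonal_mul]
  by_cases hi : i ∈ S <;> by_cases hj : j ∈ S' <;> simp [hi, hj]

theorem map_symMat {n : ℕ} (N : Fin r → Finset (Fin n)) (u : Fin t) (ε : Bool) (p q : Fin r)
    (A : Matrix (Fin n) (Fin n) ℂ) (x : (Fin t × Fin n × Fin n) × Bool → ℂ)
    (hx : ∀ i j, x (entryIdx u ε i j) = starPow ε A i j) :
    (symMat N (u, ε, p, q)).map (MvPolynomial.eval x) = starPow ε (symBlock N p q A) := by
  have hlet : ∀ p q, (letterMat N (.inl (u, ε, p, q))).map (MvPolynomial.eval x)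
      = starPow ε (if ε then blockProj (N q) * A * blockProj (N p)
        else blockProj (N p) * A * blockProj (N q)) := fun p q => by
    ext i j
    have h := hx i j
    cases ε
    · simp only [starPow, letterMat, Matrix.map_apply, Matrix.of_apply, Bool.false_eq_true,
        if_false, blockProj_mul_mul_apply] at h ⊢
      split_ifs <;> simp [h]
    · simp only [starPow, letterMat, Matrix.map_apply, Matrix.of_apply, if_true,
        Matrix.star_apply, blockProj_mul_mul_apply] at h ⊢
      by_cases hi : i ∈ N p <;> by_cases hj : j ∈ N q <;> simp [hi, hj, h]
  by_cases hpq : p = q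
  · subst hpq
    simp [symMat, symBlock, hlet]
  · rw [symMat, if_neg hpq, Matrix.map_add _ (fun a b => map_add _ a b), hlet, hlet, symBlock,
      if_neg hpq]
    cases ε
    · simp [starPow]
    · simp [starPow, add_comm]

/-- Multilinear expansion, one symmetric block at a time: `V` is the prefix already expanded into
rectangular blocks, and both sides split into the same two terms. -/
theorem tendsto_symMoment_colorFilter {N : (n : ℕ) → Fin r → Finset (Fin n)}
    (hN_disj : ∀ n, Pairwise fun p q => Disjoint (N n p) (N n q))
    (hN_ne : ∀ᶠ n in atTop, ∀ q, (N n q).Nonempty)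
    {d : Fin r → ℝ} (hd₀ : ∀ q, 0 ≤ d q)
    (hd : ∀ q, Tendsto (fun n : ℕ => ((N n q).card : ℝ) / (n : ℝ)) atTop (𝓝 (d q)))
    {v : Fin t → Fin r → Fin r → ℝ≥0}
    {L : (n : ℕ) → EntryPoly t n →ₗ[ℂ] ℂ} (hL₁ : ∀ n, L n 1 = 1)
    (hL : ∀ n, IsBlockWick (N n) v (L n)) (q : Fin r) (V W : List (BlockLetter r t)) :
    Tendsto (fun x : Σ n, Fin n =>
        L x.1 ((wordMat (N x.1) (V.map .inl) * (W.map (symMat (N x.1))).prod) x.2 x.2))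
      (colorFilter N q) (𝓝 (vacuumState q ((V.map (blockOp (blockCovariance d v))).prod
        * (W.map (symOp (blockCovariance d v))).prod))) := by
  induction W generalizing V with
  | nil =>
    have h := tendsto_moment_colorFilter hN_disj hN_ne hd₀ hd hL₁ hL (V.map .inl) [] q
    simpa [traceProd, traceLimit, vacuumState_prod_blockOp] using h
  | cons c W ih =>
    have h1 := ih (V ++ [c])
    simp only [List.map_append, List.map_cons, List.map_nil, wordMat_append, wordMat_cons,
      wordMat_nil, mul_one, List.prod_append, List.prod_cons, List.prod_nil, mul_assoc] at h1 ⊢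
    by_cases hc : c.2.2.1 = c.2.2.2
    · simpa [symMat, symOp, hc] using h1
    · have h2 := ih (V ++ [(c.1, c.2.1, c.2.2.2, c.2.2.1)])
      simp only [List.map_append, List.map_cons, List.map_nil, wordMat_append, wordMat_cons,
        wordMat_nil, mul_one, List.prod_append, List.prod_cons, List.prod_nil, mul_assoc] at h2
      have h3 := h1.add h2
      simpa only [symMat, symOp, if_neg hc, add_mul, mul_add, Matrix.add_apply, map_add,
        vacuumState_add] using h3

end SymBlocks

/-! ### The expectation as a functional on polynomials -/

section Expectation

variable {Ω : Type*} [MeasurableSpace Ω] (P : Measure Ω) [IsProbabilityMeasure P] {r t n : ℕ}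

/-- The expectation of polynomials in independent Gaussian variables. -/
def polyExpectation {S : Type*} (X : S × Bool → Ω → ℝ) (σ : S → ℝ≥0)
    (hlaw : ∀ k, HasLaw (X k) (gaussianReal 0 (σ k.1)) P) :
    MvPolynomial (S × Bool) ℂ →ₗ[ℂ] ℂ where
  toFun p := ∫ ω, MvPolynomial.eval (complexValue X ω) p ∂P
  map_add' p q := by
    simp only [map_add]
    exact integral_add (integrable_eval_complexValue hlaw p) (integrable_eval_complexValue hlaw q)
  map_smul' c p := by
    simp only [MvPolynomial.smul_eval, RingHom.id_apply, smul_eq_mul]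
    exact integral_const_mul _ _

/-- Real and imaginary parts together contribute `2 · v/(2n) = v/n`. An adjoint entry at `(i, j)`
has the variance of position `(j, i)`, hence the symmetry of `v`. -/
theorem isBlockWick_polyExpectation {N : Fin r → Finset (Fin n)} {v : Fin t → Fin r → Fin r → ℝ≥0}
    (hv : ∀ u p q, v u p q = v u q p)
    (X : (Fin t × Fin n × Fin n) × Bool → Ω → ℝ) (σ : Fin t × Fin n × Fin n → ℝ≥0)
    (hindep : iIndepFun X P) (hlaw : ∀ k, HasLaw (X k) (gaussianReal 0 (σ k.1)) P)
    (hσ : ∀ u p q i j, i ∈ N p → j ∈ N q → σ (u, i, j) = v u p q / (2 * (n : ℝ≥0))) :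
    IsBlockWick N v (polyExpectation P X σ hlaw) := by
  intro u ε p q i j hi hj F
  have hw : ∀ p q i j, i ∈ N p → j ∈ N q → 2 * (σ (u, i, j) : ℂ) = (v u p q : ℂ) / n := by
    intro p q i j hi hj
    rw [hσ u p q i j hi hj]
    push_cast
    have : (n : ℂ) ≠ 0 := by
      have := i.pos
      exact_mod_cast this.ne'
    field_simp
  cases ε
  · have h := integral_complex_X_mul hindep hlaw (u, i, j) false F
    rw [hw p q i j hi hj] at h
    exact h
  · have h := integral_complex_X_mul hindep hlaw (u, j, i) true F
    rw [hw q p j i hj hi, hv] at h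
    exact h

end Expectation

end MatricialFock

end

theorem theorem8p1
    {Ω : Type*} [MeasurableSpace Ω] (P : Measure Ω) [IsProbabilityMeasure P]
    (r t : ℕ)
    -- for each `n`, a partition of `[n]` into disjoint nonempty intervals `N_1, …, N_r`
    (N : (n : ℕ) → Fin r → Finset (Fin n))
    (hN_disj : ∀ n, Pairwise fun p q => Disjoint (N n p) (N n q))
    (hN_cover : ∀ n (j : Fin n), ∃ q, j ∈ N n q)
    (hN_int : ∀ n q, (N n q : Set (Fin n)).OrdConnected)
    (hN_ne : ∀ᶠ n in atTop, ∀ q, (N n q).Nonempty)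
    -- asymptotic dimensions (possibly zero)
    (d : Fin r → ℝ)
    (hd : ∀ q, Tendsto (fun n : ℕ => ((N n q).card : ℝ) / (n : ℝ)) atTop (𝓝 (d q)))
    -- symmetric block variance matrices
    (v : Fin t → Fin r → Fin r → ℝ≥0)
    (hv : ∀ u p q, v u p q = v u q p)
    -- the random matrices
    (Y : Fin t → (n : ℕ) → Ω → Matrix (Fin n) (Fin n) ℂ)
    (hY_indep : ∀ n : ℕ, iIndepFun
      (fun (k : Fin t × Fin n × Fin n × Bool) (ω : Ω) =>
        MatricialFock.reIm k.2.2.2 (Y k.1 n ω k.2.1 k.2.2.1)) P)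
    (hY_law : ∀ (u : Fin t) (n : ℕ) (p q : Fin r) (i j : Fin n), i ∈ N n p → j ∈ N n q →
      ∀ c : Bool, HasLaw (fun ω => MatricialFock.reIm c (Y u n ω i j))
        (gaussianReal 0 (v u p q / (2 * (n : ℝ≥0)))) P)
    -- the mixed *-moment
    (m : ℕ) (ε : Fin m → Bool) (u : Fin m → Fin t) (p q : Fin m → Fin r) (q₀ : Fin r) :
    (∀ n : ℕ, Integrable (fun ω => MatricialFock.partialTrace (N n q₀)
        (List.ofFn fun k => MatricialFock.starPow (ε k)
          (MatricialFock.symBlock (N n) (p k) (q k) (Y (u k) n ω))).prod) P) ∧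
    Tendsto
      (fun n : ℕ => MatricialFock.expPartialTrace P (N n q₀) fun ω =>
        (List.ofFn fun k => MatricialFock.starPow (ε k)
          (MatricialFock.symBlock (N n) (p k) (q k) (Y (u k) n ω))).prod)
      atTop
      (𝓝 (MatricialFock.vacuumState q₀
        (List.ofFn fun k => MatricialFock.starPow (ε k)
          (MatricialFock.eta d v (p k) (q k) (u k))).prod)) := by
  classical
  have hd₀ : ∀ q, 0 ≤ d q := fun q =>
    ge_of_tendsto' (hd q) fun n => div_nonneg (Nat.cast_nonneg _) (Nat.cast_nonneg _)
  -- Choosing a colour for each index gives every entry a definite variance. Disjointness later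
  -- shows that the choice is the only one possible.
  choose col hcol using hN_cover
  let σ : (n : ℕ) → Fin t × Fin n × Fin n → ℝ≥0 := fun n s =>
    v s.1 (col n s.2.1) (col n s.2.2) / (2 * (n : ℝ≥0))
  let X : (n : ℕ) → (Fin t × Fin n × Fin n) × Bool → Ω → ℝ := fun n k ω =>
    MatricialFock.reIm k.2 (Y k.1.1 n ω k.1.2.1 k.1.2.2)
  have hlaw : ∀ n k, HasLaw (X n k) (gaussianReal 0 (σ n k.1)) P := fun n k =>
    hY_law k.1.1 n _ _ k.1.2.1 k.1.2.2 (hcol n _) (hcol n _) k.2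
  have hindep : ∀ n, iIndepFun (X n) P := fun n =>
    (hY_indep n).precomp (g := fun k : (Fin t × Fin n × Fin n) × Bool =>
      (k.1.1, k.1.2.1, k.1.2.2, k.2)) (by
        rintro ⟨⟨u, i, j⟩, c⟩ ⟨⟨u', i', j'⟩, c'⟩ h
        simp only [Prod.mk.injEq] at h ⊢
        tauto)
  let L := fun n => MatricialFock.polyExpectation P (X n) (σ n) (hlaw n)
  have hL₁ : ∀ n, L n 1 = 1 := fun n => by simp [L, MatricialFock.polyExpectation]
  have hL : ∀ n, MatricialFock.IsBlockWick (N n) v (L n) := fun n =>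
    MatricialFock.isBlockWick_polyExpectation P hv (X n) (σ n) (hindep n) (hlaw n)
      fun u p q i j hi hj => by
        have h1 := MatricialFock.eq_of_mem_of_mem (hN_disj n) (hcol n i) hi
        have h2 := MatricialFock.eq_of_mem_of_mem (hN_disj n) (hcol n j) hj
        simp only [σ, h1, h2]
  let W : List (MatricialFock.BlockLetter r t) := List.ofFn fun k => (u k, ε k, p k, q k)
  have hval : ∀ n ω (u : Fin t) (ε : Bool) (i j : Fin n),
      MatricialFock.complexValue (X n) ω (MatricialFock.entryIdx u ε i j)
        = MatricialFock.starPow ε (Y u n ω) i j := fun n ω u ε i j => by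
    cases ε
    · simp [MatricialFock.complexValue, MatricialFock.entryIdx, MatricialFock.starPow, X,
        MatricialFock.reIm, MatricialFock.conjUnit, mul_comm Complex.I]
    · apply Complex.ext <;>
        simp [MatricialFock.complexValue, MatricialFock.entryIdx, MatricialFock.starPow, X,
          MatricialFock.reIm, MatricialFock.conjUnit, Matrix.star_apply]
  have hprod : ∀ n ω, (List.ofFn fun k => MatricialFock.starPow (ε k)
        (MatricialFock.symBlock (N n) (p k) (q k) (Y (u k) n ω))).prod
      = ((W.map (MatricialFock.symMat (N n))).prod).map
          (MvPolynomial.eval (MatricialFock.complexValue (X n) ω)) := fun n ω => by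
    have h := map_list_prod (MvPolynomial.eval (MatricialFock.complexValue (X n) ω)).mapMatrix
      (W.map (MatricialFock.symMat (N n)))
    rw [RingHom.mapMatrix_apply] at h
    rw [h]
    congr 1
    simp only [W, List.map_ofFn]
    congr 1
    funext k
    simp only [Function.comp_apply, RingHom.mapMatrix_apply]
    exact (MatricialFock.map_symMat (N n) (u k) (ε k) (p k) (q k) (Y (u k) n ω) _
      (hval n ω (u k) (ε k))).symm
  have hint : ∀ n (j : Fin n), Integrable (fun ω => MvPolynomial.eval
      (MatricialFock.complexValue (X n) ω) ((W.map (MatricialFock.symMat (N n))).prod j j)) P :=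
    fun n j => MatricialFock.integrable_eval_complexValue (hlaw n) _
  have htrace : ∀ n ω, MatricialFock.partialTrace (N n q₀)
        (List.ofFn fun k => MatricialFock.starPow (ε k)
          (MatricialFock.symBlock (N n) (p k) (q k) (Y (u k) n ω))).prod
      = (∑ j ∈ N n q₀, MvPolynomial.eval (MatricialFock.complexValue (X n) ω)
          ((W.map (MatricialFock.symMat (N n))).prod j j)) / ((N n q₀).card : ℂ) := fun n ω => by
    rw [hprod]
    rfl
  refine ⟨fun n => ?_, ?_⟩
  · simp_rw [htrace]
    exact (integrable_finsetSum _ fun j _ => hint n j).div_const _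
  · have hmain := MatricialFock.tendsto_average_colorFilter (hN_ne.mono fun _ h => h q₀)
      (MatricialFock.tendsto_symMoment_colorFilter hN_disj hN_ne hd₀ hd hL₁ hL q₀ [] W)
    have hW : W.map (MatricialFock.symOp (MatricialFock.blockCovariance d v))
        = List.ofFn fun k => MatricialFock.starPow (ε k)
          (MatricialFock.eta d v (p k) (q k) (u k)) := by
      simp only [W, List.map_ofFn, MatricialFock.starPow_eta_eq_symOp]
      rfl
    simp only [List.map_nil, List.prod_nil, one_mul, MatricialFock.wordMat_nil, hW] at hmain
    refine hmain.congr fun n => ?_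
    simp only [MatricialFock.expPartialTrace, htrace]
    rw [integral_div, integral_finsetSum _ fun j _ => hint n j]
    rfl
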